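/- **Theorem 5.2.** Let $\langle v,w\rangle_{2,1}=v_1w_1+v_2w_2-v_3w_3$ on $\mathbb R^3$ and let $$\mathbb H=\{x\in\mathbb R^3:\ \langle x,x\rangle_{2,1}=-1,\ x_3>0\}$$ be the $2$-dimensional hyperbolic space, with the Riemannian metric induced by $\langle\cdot,\cdot\rangle_{2,1}$. Then $\mathbb H$, with its Riemannian exponential map, has $S_1$-bounded geometry. Explicitly: 1. For every $z\in\mathbb H$ and $v\in T_z\mathbb H$ there is exactly one geodesic $\gamma:\mathbb R\to\mathbb H$ with $\gamma(0)=z$ and $\gamma'(0)=v$, so that $\exp:T\mathbb H\to\mathbb H$, $\exp_z(v):=\gamma(1)$, is well defined. 2. $(\mathbb H,\exp)$ is an exponential manifold: $\exp:T\mathbb H\to\mathbb H$ is smooth and, for every $z\in\mathbb H$, $\exp_z:T_z\mathbb H\to\mathbb H$ is a global diffeomorphism with $\exp_z(0)=z$ and $(d\exp_z)_0=\mathrm{Id}_{T_z\mathbb H}$. 3. For $z\in\mathbb H$ and a basis $\mathfrak b$ of $T_z\mathbb H$, put $n_z^{\mathfrak b}:=L_{\mathfrak b}\circ\exp_z^{-1}:\mathbb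 H\to\mathbb R^2$, where $L_{\mathfrak b}:T_z\mathbb H\to\mathbb R^2$ is the coordinate isomorphism of $\mathfrak b$. For all $z,z'\in\mathbb H$, all bases $\mathfrak b$ of $T_z\mathbb H$ and $\mathfrak b'$ of $T_{z'}\mathbb H$, and every multi-index $\alpha\in\mathbb N^2\setminus\{0\}$, the normal coordinate change $\psi_{z,z'}^{\mathfrak b,\mathfrak b'}:=n_z^{\mathfrak b}\circ(n_{z'}^{\mathfrak b'})^{-1}:\mathbb R^2\to\mathbb R^2$ satisfies, for some constant $C$ (depending on $z,z',\mathfrak b,\mathfrak b',\alpha$), $$\|\partial^\alpha\psi_{z,z'}^{\mathfrak b,\mathfrak b'}(x)\|\le C\,\langle x\rangle^{-(|\alpha|-1)}\qquad\text{for all }x\in\mathbb R^2,\qquad \langle x\rangle:=(1+\|x\|^2)^{1/2}.$$ -/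

import Mathlib

open scoped Manifold ContDiff Topology
open Bundle

/-! ### Partial derivatives on `ℝⁿ` -/

/-- The Euclidean space `ℝⁿ`. -/
abbrev Eucl (n : ℕ) : Type := EuclideanSpace ℝ (Fin n)

/-- The partial derivative `∂ᵢ f` of a map on `ℝⁿ`. -/
noncomputable def pderiv {n : ℕ} {F : Type*} [NormedAddCommGroup F] [NormedSpace ℝ F]
    (i : Fin n) (f : Eucl n → F) : Eucl n → F :=
  fun x => fderiv ℝ f x (EuclideanSpace.single i 1)

/-- The iterated partial derivative `∂^α f = ∂₁^{α₁} ⋯ ∂ₙ^{αₙ} f` for a multi-index `α`. -/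
noncomputable def multiDeriv {n : ℕ} {F : Type*} [NormedAddCommGroup F] [NormedSpace ℝ F]
    (α : Fin n → ℕ) (f : Eucl n → F) : Eucl n → F :=
  (List.finRange n).foldr (fun i g => (pderiv i)^[α i] g) f

/-- The bracket `⟨x⟩ = (1 + ‖x‖²)^{1/2}`. -/
noncomputable def japaneseBracket {n : ℕ} (x : Eucl n) : ℝ := Real.sqrt (1 + ‖x‖ ^ 2)

/-! ### Exponential manifolds and `S_σ`-bounded geometry -/

section Exponential

variable {n : ℕ} {M : Type*} [TopologicalSpace M] [ChartedSpace (Eucl n) M]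
  [IsManifold (𝓡 n) ∞ M]

/-- `(M, exp)` is an exponential manifold: `exp : TM → M` is smooth, every
`exp_x : T_x M → M` is a global diffeomorphism, `exp_x 0 = x` and `(d exp_x)_0 = id`.
(In Mathlib the tangent space `T_x M` is the model space `ℝⁿ`; the last field says that `T exp_x`
sends the tangent vector `v` of `T_x M` at `0` to the tangent vector `v` of `M` at `x`.) -/
structure IsExponentialManifold (exp : TangentBundle (𝓡 n) M → M) : Prop where
  smooth : ContMDiff (𝓡 n).tangent (𝓡 n) ∞ exp
  diffeo : ∀ x : M, ∃ Φ : Eucl n ≃ₘ^∞⟮𝓡 n, 𝓡 n⟯ M,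
    ∀ v : TangentSpace (𝓡 n) x, Φ v = exp ⟨x, v⟩
  exp_zero : ∀ x : M, exp ⟨x, 0⟩ = x
  deriv_zero : ∀ (x : M) (v : TangentSpace (𝓡 n) x),
    tangentMap (𝓡 n) (𝓡 n) (fun w : Eucl n => exp ⟨x, w⟩) ⟨0, v⟩ = ⟨x, v⟩

/-- The normal chart `n_z^b = L_b ∘ exp_z⁻¹ : M → ℝⁿ` of a frame `(z, b)`, where
`L_b : T_z M → ℝⁿ` is the coordinate isomorphism of the basis `b`. -/
noncomputable def normalChart (exp : TangentBundle (𝓡 n) M → M) (z : M)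
    (b : Module.Basis (Fin n) ℝ (TangentSpace (𝓡 n) z)) (x : M) : Eucl n :=
  WithLp.toLp 2
    (b.equivFun (Function.invFun (fun v : TangentSpace (𝓡 n) z => exp ⟨z, v⟩) x))

/-- The inverse `(n_z^b)⁻¹ = exp_z ∘ L_b⁻¹ : ℝⁿ → M` of the normal chart. -/
noncomputable def normalChartInv (exp : TangentBundle (𝓡 n) M → M) (z : M)
    (b : Module.Basis (Fin n) ℝ (TangentSpace (𝓡 n) z)) (y : Eucl n) : M :=
  exp ⟨z, b.equivFun.symm (WithLp.ofLp y)⟩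

/-- The normal coordinate change `ψ_{z,z'}^{b,b'} = n_z^b ∘ (n_{z'}^{b'})⁻¹ : ℝⁿ → ℝⁿ`. -/
noncomputable def normalChange (exp : TangentBundle (𝓡 n) M → M) (z z' : M)
    (b : Module.Basis (Fin n) ℝ (TangentSpace (𝓡 n) z))
    (b' : Module.Basis (Fin n) ℝ (TangentSpace (𝓡 n) z')) : Eucl n → Eucl n :=
  normalChart exp z b ∘ normalChartInv exp z' b'

/-- `(M, exp)` is an exponential manifold with `S_σ`-bounded geometry. -/
structure HasSBoundedGeometry (σ : ℝ) (exp : TangentBundle (𝓡 n) M → M) : Prop where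
  isExponentialManifold : IsExponentialManifold exp
  bound : ∀ (z z' : M) (b : Module.Basis (Fin n) ℝ (TangentSpace (𝓡 n) z))
    (b' : Module.Basis (Fin n) ℝ (TangentSpace (𝓡 n) z')) (α : Fin n → ℕ), α ≠ 0 →
    ∃ C : ℝ, ∀ x : Eucl n, ‖multiDeriv α (normalChange exp z z' b b') x‖ ≤
      C * japaneseBracket x ^ (-σ * (((∑ i, α i : ℕ) : ℝ) - 1))

end Exponential

/-! ### Geodesics and the Riemannian exponential map -/

section Riemannian

variable {n : ℕ} {M : Type*} [TopologicalSpace M] [ChartedSpace (Eucl n) M]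
  [IsManifold (𝓡 n) ∞ M]

/-- Smooth Riemannian metrics on an `n`-dimensional smooth manifold. -/
abbrev SmoothRiemannianMetric (n : ℕ) (M : Type*) [TopologicalSpace M]
    [ChartedSpace (Eucl n) M] [IsManifold (𝓡 n) ∞ M] :=
  ContMDiffRiemannianMetric (𝓡 n) ∞ (Eucl n) (fun p : M => TangentSpace (𝓡 n) p)

/-- The coordinate vector field `∂ᵢ` of the chart at `x₀`, at the point with coordinates `u`. -/
noncomputable def coordField (x₀ : M) (u : Eucl n) (i : Fin n) :
    TangentSpace (𝓡 n) ((chartAt (Eucl n) x₀).symm u) :=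
  mfderiv (𝓡 n) (𝓡 n) (chartAt (Eucl n) x₀).symm u (EuclideanSpace.single i (1 : ℝ) : Eucl n)

/-- The matrix `(g_{ij}(u))` of the metric in the chart at `x₀`. -/
noncomputable def metricMatrix (g : SmoothRiemannianMetric n M) (x₀ : M) (u : Eucl n) :
    Matrix (Fin n) (Fin n) ℝ :=
  Matrix.of fun i j => g.inner ((chartAt (Eucl n) x₀).symm u) (coordField x₀ u i) (coordField x₀ u j)

/-- The Christoffel symbols
`Γᵏ_{ij} = ½ ∑ₗ g^{kl} (∂ᵢ g_{jl} + ∂ⱼ g_{il} - ∂ₗ g_{ij})` of the Levi-Civita connection in the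
chart at `x₀`. -/
noncomputable def christoffel (g : SmoothRiemannianMetric n M) (x₀ : M) (u : Eucl n)
    (k i j : Fin n) : ℝ :=
  (1 / 2) * ∑ l, (metricMatrix g x₀ u)⁻¹ k l *
    (pderiv i (fun w => metricMatrix g x₀ w j l) u
      + pderiv j (fun w => metricMatrix g x₀ w i l) u
      - pderiv l (fun w => metricMatrix g x₀ w i j) u)

/-- A smooth curve `γ : ℝ → M` is a geodesic if, at each time `t`, it satisfies the geodesic equation
`c̈ᵏ + ∑_{i,j} Γᵏ_{ij}(c) ċⁱ ċʲ = 0` in the chart `c` at `γ t`. -/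
def IsGeodesic (g : SmoothRiemannianMetric n M) (γ : ℝ → M) : Prop :=
  ContMDiff 𝓘(ℝ, ℝ) (𝓡 n) ∞ γ ∧
    ∀ (t : ℝ) (k : Fin n),
      let c : Fin n → ℝ → ℝ := fun i s => chartAt (Eucl n) (γ t) (γ s) i
      deriv (deriv (c k)) t +
        ∑ i, ∑ j, christoffel g (γ t) (chartAt (Eucl n) (γ t) (γ t)) k i j *
          deriv (c i) t * deriv (c j) t = 0

/-- The velocity `γ'(t) ∈ TM` of a curve in `M`. -/
noncomputable def velocity (γ : ℝ → M) (t : ℝ) : TangentBundle (𝓡 n) M :=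
  tangentMap 𝓘(ℝ, ℝ) (𝓡 n) γ ⟨t, (1 : ℝ)⟩

open Classical in
/-- The Riemannian exponential map: `exp v = γ(1)`, where `γ : ℝ → M` is the geodesic with
`γ'(0) = v`. (The value is `π(v)` if there is no such geodesic, which is excluded when the manifold
is geodesically complete.) -/
noncomputable def riemannianExp (g : SmoothRiemannianMetric n M) (v : TangentBundle (𝓡 n) M) : M :=
  if h : ∃ γ : ℝ → M, IsGeodesic g γ ∧ velocity γ 0 = v then h.choose 1 else v.proj

end Riemannian

/-! ### The hyperbolic plane (hyperboloid model) -/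

/-- The Minkowski bilinear form `⟨v, w⟩ = v₁w₁ + v₂w₂ - v₃w₃` on `ℝ³`. -/
noncomputable def minkowski : Eucl 3 →L[ℝ] Eucl 3 →L[ℝ] ℝ :=
  (EuclideanSpace.proj (𝕜 := ℝ) (0 : Fin 3)).smulRight (EuclideanSpace.proj (𝕜 := ℝ) (0 : Fin 3))
  + (EuclideanSpace.proj (𝕜 := ℝ) (1 : Fin 3)).smulRight
      (EuclideanSpace.proj (𝕜 := ℝ) (1 : Fin 3))
  - (EuclideanSpace.proj (𝕜 := ℝ) (2 : Fin 3)).smulRight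
      (EuclideanSpace.proj (𝕜 := ℝ) (2 : Fin 3))

theorem minkowski_apply (v w : Eucl 3) :
    minkowski v w = v 0 * w 0 + v 1 * w 1 - v 2 * w 2 := by
  simp [minkowski]

/-- The hyperbolic plane `ℍ = {x ∈ ℝ³ : ⟨x, x⟩ = -1, x₃ > 0}`. -/
def HyperbolicPlane : Type := {x : Eucl 3 // minkowski x x = -1 ∧ 0 < x 2}

namespace HyperbolicPlane

instance : TopologicalSpace HyperbolicPlane :=
  inferInstanceAs (TopologicalSpace {x : Eucl 3 // minkowski x x = -1 ∧ 0 < x 2})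

/-- The inclusion `ℍ → ℝ³`. -/
def incl (p : HyperbolicPlane) : Eucl 3 := p.1

/-- The map `u ↦ (u₁, u₂, √(1 + u₁² + u₂²))`, which has `ℍ` as its graph. -/
noncomputable def graphMap (u : Eucl 2) : Eucl 3 :=
  !₂[u 0, u 1, Real.sqrt (1 + u 0 ^ 2 + u 1 ^ 2)]

theorem graphMap_pos (u : Eucl 2) : 0 < 1 + u 0 ^ 2 + u 1 ^ 2 := by positivity

theorem contDiff_graphMap : ContDiff ℝ ∞ graphMap := by
  rw [contDiff_euclidean]
  have h0 : ContDiff ℝ ∞ (fun u : Eucl 2 => u 0) := contDiff_piLp_apply 2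
  have h1 : ContDiff ℝ ∞ (fun u : Eucl 2 => u 1) := contDiff_piLp_apply 2
  intro i
  fin_cases i
  · simpa [graphMap] using h0
  · simpa [graphMap] using h1
  · have : ContDiff ℝ ∞ (fun u : Eucl 2 => Real.sqrt (1 + u 0 ^ 2 + u 1 ^ 2)) :=
      ((contDiff_const.add (h0.pow 2)).add (h1.pow 2)).sqrt (fun u => (graphMap_pos u).ne')
    simpa [graphMap] using this

theorem graphMap_mem (u : Eucl 2) :
    minkowski (graphMap u) (graphMap u) = -1 ∧ 0 < graphMap u 2 := by
  have h := graphMap_pos u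
  rw [minkowski_apply]
  refine ⟨?_, ?_⟩
  · simp only [graphMap, PiLp.toLp_apply, Matrix.cons_val]
    rw [Real.mul_self_sqrt h.le]; ring
  · simpa [graphMap] using h

/-- The projection `(x₁, x₂, x₃) ↦ (x₁, x₂)` is a homeomorphism `ℍ ≃ ℝ²`. -/
noncomputable def projHomeo : HyperbolicPlane ≃ₜ Eucl 2 where
  toFun p := !₂[p.incl 0, p.incl 1]
  invFun u := ⟨graphMap u, graphMap_mem u⟩
  left_inv p := by
    obtain ⟨x, hx, hx2⟩ := p
    apply Subtype.ext
    rw [minkowski_apply] at hx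
    have : Real.sqrt (1 + x 0 ^ 2 + x 1 ^ 2) = x 2 := by
      rw [show 1 + x 0 ^ 2 + x 1 ^ 2 = x 2 ^ 2 by linarith [hx]]
      exact Real.sqrt_sq hx2.le
    ext i
    fin_cases i <;> simp [graphMap, incl, this]
  right_inv u := by
    ext i
    fin_cases i <;> simp [graphMap, incl]
  continuous_toFun := by
    have h : Continuous incl := continuous_subtype_val
    refine (PiLp.continuous_toLp 2 _).comp (continuous_pi fun i => ?_)
    fin_cases i
    · exact (EuclideanSpace.proj (𝕜 := ℝ) (0 : Fin 3)).continuous.comp h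
    · exact (EuclideanSpace.proj (𝕜 := ℝ) (1 : Fin 3)).continuous.comp h
  continuous_invFun := Continuous.subtype_mk contDiff_graphMap.continuous graphMap_mem

/-- The smooth structure of `ℍ` as a submanifold of `ℝ³`: since `ℍ` is the graph of the smooth
function `u ↦ √(1 + u₁² + u₂²)`, the projection to the first two coordinates is a global chart. -/
noncomputable instance : ChartedSpace (Eucl 2) HyperbolicPlane :=
  projHomeo.toOpenPartialHomeomorph.singletonChartedSpace rfl

instance : IsManifold (𝓡 2) ∞ HyperbolicPlane :=
  projHomeo.toOpenPartialHomeomorph.isManifold_singleton rfl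

theorem chartAt_eq (p : HyperbolicPlane) :
    chartAt (Eucl 2) p = projHomeo.toOpenPartialHomeomorph := rfl

theorem hasMFDerivAt_incl (p : HyperbolicPlane) :
    HasMFDerivAt (𝓡 2) (𝓡 3) incl p (fderiv ℝ graphMap (projHomeo p)) := by
  refine ⟨continuous_subtype_val.continuousAt, ?_⟩
  have : writtenInExtChartAt (𝓡 2) (𝓡 3) p incl = graphMap := by
    funext u
    simp only [writtenInExtChartAt, extChartAt, chartAt_self_eq, mfld_simps]
    rfl
  rw [this]
  simp only [extChartAt, chartAt_eq]
  exact (contDiff_graphMap.differentiable (by simp) _).hasFDerivAt.hasFDerivWithinAt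

theorem fderiv_graphMap_apply (u v : Eucl 2) (i : Fin 3) :
    fderiv ℝ graphMap u v i = fderiv ℝ (fun w => graphMap w i) u v := by
  have h := (contDiff_graphMap.differentiable (by simp) u).hasFDerivAt
  have := ((EuclideanSpace.proj (𝕜 := ℝ) i).hasFDerivAt (x := graphMap u)).comp u h
  have h2 : fderiv ℝ (fun w => graphMap w i) u = _ := this.fderiv
  rw [h2]
  rfl

theorem minkowski_fderiv_graphMap (u v : Eucl 2) :
    minkowski (fderiv ℝ graphMap u v) (fderiv ℝ graphMap u v) =
      v 0 ^ 2 + v 1 ^ 2 - (u 0 * v 0 + u 1 * v 1) ^ 2 / (1 + u 0 ^ 2 + u 1 ^ 2) := by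
  have hp (i : Fin 2) : HasFDerivAt (fun w : Eucl 2 => w i) (EuclideanSpace.proj (𝕜 := ℝ) i) u :=
    (EuclideanSpace.proj (𝕜 := ℝ) i).hasFDerivAt
  have e0 : fderiv ℝ graphMap u v 0 = v 0 := by
    rw [fderiv_graphMap_apply]
    exact congrArg (fun L => L v) (hp 0).fderiv
  have e1 : fderiv ℝ graphMap u v 1 = v 1 := by
    rw [fderiv_graphMap_apply]
    exact congrArg (fun L => L v) (hp 1).fderiv
  have e2 : fderiv ℝ graphMap u v 2 =
      (u 0 * v 0 + u 1 * v 1) / Real.sqrt (1 + u 0 ^ 2 + u 1 ^ 2) := by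
    rw [fderiv_graphMap_apply]
    have hs := ((((hp 0).pow 2).const_add 1).add ((hp 1).pow 2)).sqrt (graphMap_pos u).ne'
    refine (congrArg (fun L => L v) hs.fderiv).trans ?_
    simp
    field_simp
  have hq := graphMap_pos u
  rw [minkowski_apply, e0, e1, e2, div_mul_div_comm, Real.mul_self_sqrt hq.le]
  ring

/-- The form induced by the Minkowski form on the tangent spaces of `ℍ` is bounded below. -/
theorem minkowski_fderiv_graphMap_ge (u v : Eucl 2) :
    ‖v‖ ^ 2 / (1 + u 0 ^ 2 + u 1 ^ 2) ≤
      minkowski (fderiv ℝ graphMap u v) (fderiv ℝ graphMap u v) := by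
  have hq := graphMap_pos u
  rw [minkowski_fderiv_graphMap, EuclideanSpace.norm_sq_eq, Fin.sum_univ_two]
  simp only [Real.norm_eq_abs, sq_abs]
  rw [div_le_iff₀ hq, sub_mul, div_mul_cancel₀ _ hq.ne']
  nlinarith [sq_nonneg (u 0 * v 1 - u 1 * v 0)]

/-- The bilinear form `⟨dι v, dι w⟩` on `T_p ℍ` induced by the inclusion `ι : ℍ → ℝ³`. -/
noncomputable def inducedForm (p : HyperbolicPlane) :
    TangentSpace (𝓡 2) p →L[ℝ] TangentSpace (𝓡 2) p →L[ℝ] ℝ :=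
  let dι : Eucl 2 →L[ℝ] Eucl 3 := mfderiv (𝓡 2) (𝓡 3) incl p
  (minkowski.bilinearComp dι dι : Eucl 2 →L[ℝ] Eucl 2 →L[ℝ] ℝ)

theorem inducedForm_apply (p : HyperbolicPlane) (v w : Eucl 2) :
    inducedForm p v w = minkowski (fderiv ℝ graphMap (projHomeo p) v)
      (fderiv ℝ graphMap (projHomeo p) w) := by
  have h := (hasMFDerivAt_incl p).mfderiv
  have hv : (mfderiv (𝓡 2) (𝓡 3) incl p : Eucl 2 →L[ℝ] Eucl 3) v
      = fderiv ℝ graphMap (projHomeo p) v := congrArg (fun L : Eucl 2 →L[ℝ] Eucl 3 => L v) h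
  have hw : (mfderiv (𝓡 2) (𝓡 3) incl p : Eucl 2 →L[ℝ] Eucl 3) w
      = fderiv ℝ graphMap (projHomeo p) w := congrArg (fun L : Eucl 2 →L[ℝ] Eucl 3 => L w) h
  exact congrArg₂ (fun a b : Eucl 3 => minkowski a b) hv hw

theorem symm_trivializationAt (p q : HyperbolicPlane) (v : Eucl 2) :
    (trivializationAt (Eucl 2) (TangentSpace (𝓡 2)) p).symm q v = v := by
  have h := TangentBundle.symmL_trivializationAt_eq_core (I := 𝓡 2) (b₀ := p) (b := q)
    (by simp)
  have h2 := congrArg (fun L => L v) h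
  refine Eq.trans ?_ (h2.trans ?_)
  · exact (Trivialization.symmL_apply _ (by simp) v).symm
  exact (tangentBundleCore (𝓡 2) HyperbolicPlane).coordChange_self _ q (by simp) v

theorem contDiff_bilinearComp {E F : Type*} [NormedAddCommGroup E] [NormedSpace ℝ E]
    [NormedAddCommGroup F] [NormedSpace ℝ F] (B : F →L[ℝ] F →L[ℝ] ℝ) {A : E → E →L[ℝ] F}
    (hA : ContDiff ℝ ∞ A) : ContDiff ℝ ∞ (fun u => B.bilinearComp (A u) (A u)) := by
  have h1 : ContDiff ℝ ∞ fun u => (ContinuousLinearMap.compL ℝ E F ℝ).flip (A u) :=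
    (ContinuousLinearMap.contDiff _).comp hA
  exact h1.clm_comp ((contDiff_const (c := B)).clm_comp hA)

theorem contMDiff_inducedForm :
    ContMDiff (𝓡 2) ((𝓡 2).prod 𝓘(ℝ, Eucl 2 →L[ℝ] Eucl 2 →L[ℝ] ℝ)) ∞
      (fun p : HyperbolicPlane => TotalSpace.mk' (Eucl 2 →L[ℝ] Eucl 2 →L[ℝ] ℝ)
        (E := fun p : HyperbolicPlane =>
          TangentSpace (𝓡 2) p →L[ℝ] TangentSpace (𝓡 2) p →L[ℝ] ℝ) p (inducedForm p)) := by
  intro p₀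
  rw [contMDiffAt_hom_bundle]
  refine ⟨contMDiffAt_id, ?_⟩
  have key : ContMDiff (𝓡 2) 𝓘(ℝ, Eucl 2 →L[ℝ] Eucl 2 →L[ℝ] ℝ) ∞
      (fun p : HyperbolicPlane => minkowski.bilinearComp (fderiv ℝ graphMap (projHomeo p))
        (fderiv ℝ graphMap (projHomeo p))) := by
    have h1 : ContDiff ℝ ∞ (fderiv ℝ graphMap) :=
      contDiff_graphMap.fderiv_right (m := ∞) (by simp)
    have h2 : ContDiff ℝ ∞ (fun u => minkowski.bilinearComp (fderiv ℝ graphMap u)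
        (fderiv ℝ graphMap u)) := by
      exact contDiff_bilinearComp minkowski h1
    have h4 : ContMDiff (𝓡 2) (𝓡 2) ∞ (fun p : HyperbolicPlane => projHomeo p) := by
      intro q
      exact contMDiffAt_extChartAt (I := 𝓡 2) (x := q)
    exact h2.contMDiff.comp h4
  refine (key p₀).congr_of_eventuallyEq (Filter.Eventually.of_forall fun p => ?_)
  ext v w
  refine (inCoordinates_apply_eq₂ (by simp) (by simp) (by simp)).trans ?_
  simp only [symm_trivializationAt]
  refine Eq.trans ?_ (inducedForm_apply p v w)
  simp

theorem inducedForm_pos (p : HyperbolicPlane) (v : Eucl 2) (hv : v ≠ 0) :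
    0 < inducedForm p v v := by
  rw [inducedForm_apply]
  refine lt_of_lt_of_le ?_ (minkowski_fderiv_graphMap_ge (projHomeo p) v)
  have : 0 < ‖v‖ := norm_pos_iff.mpr hv
  have := graphMap_pos (projHomeo p)
  positivity

theorem isVonNBounded_inducedForm (p : HyperbolicPlane) :
    Bornology.IsVonNBounded ℝ {v : Eucl 2 | inducedForm p v v < 1} := by
  have hq := graphMap_pos (projHomeo p)
  refine (NormedSpace.isVonNBounded_closedBall ℝ (Eucl 2)
    (1 + projHomeo p 0 ^ 2 + projHomeo p 1 ^ 2)).subset ?_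
  intro v hv
  rw [Set.mem_ofPred_eq, inducedForm_apply] at hv
  have h1 := (minkowski_fderiv_graphMap_ge (projHomeo p) v).trans_lt hv
  rw [div_lt_one hq] at h1
  have : ‖v‖ ≤ 1 + projHomeo p 0 ^ 2 + projHomeo p 1 ^ 2 := by
    nlinarith [sq_nonneg (projHomeo p 0), sq_nonneg (projHomeo p 1), norm_nonneg v]
  simpa [Metric.mem_closedBall] using this

/-- The Riemannian metric of the hyperbolic plane, induced by the Minkowski form. -/
noncomputable def metric : SmoothRiemannianMetric 2 HyperbolicPlane where
  inner := inducedForm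
  symm p v w := by
    refine (inducedForm_apply p v w).trans (Eq.trans ?_ (inducedForm_apply p w v).symm)
    simp only [minkowski_apply]
    ring
  pos p v hv := inducedForm_pos p v hv
  isVonNBounded p := isVonNBounded_inducedForm p
  contMDiff := contMDiff_inducedForm

end HyperbolicPlane

/-!
Since `ℍ` is the graph of `height u = √(1 + |u|²)`, everything is computed in the global chart
`u ∈ ℝ²`, in which the tangent spaces of Mathlib are literally `ℝ²`.

*Geodesics.* The Christoffel symbols are `Γᵏᵢⱼ = -gᵢⱼ uₖ` (`christoffel_eq`), so the geodesic
equation reads `c̈ = g(ċ, ċ) c` (`isGeodesic_iff`). Along a solution the speed `s = g(ċ, ċ)` is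
constant, so the equation becomes the linear equation `c̈ = s c`, which has exactly one solution
with given initial values (`eq_expCoord_of_geodesicEquation`). This gives existence and uniqueness
of geodesics, and the formula
`exp_u v = cosh |v| • u + (sinh |v| / |v|) • v` (`riemannianExp_mkTangent`).

*Exponential manifold.* The functions `cosh √s` and `sinh √s / √s` are entire, so `exp` is smooth.
The inverse of `exp_u` is `w ↦ (arcosh c / √(c² - 1)) • (w - c u)`, with `c` the hyperbolic cosine
of the distance. The coefficient is smooth up to `c = 1`, because `arcosh²` is the inverse of
`cosh √s`, whose derivative does not vanish (`contDiffOn_arcosh_sq`).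

*Symbol estimates.* A function `f` on `ℝⁿ` is a symbol of order one as soon as `ε f(x / ε)` extends
smoothly across `ε = 0` near the unit sphere: `∂_x^α` of this function is
`ε^(1 - |α|) (∂^α f)(x / ε)`, and it is bounded near the compact set `ε = 0`, `|x| = 1`
(`exists_symbol_bound`). For a normal coordinate change, put `R = |v|` and `e = exp (-2R)`. The
point `exp_{u'} v` is `exp R / 2` times a vector depending smoothly on `e` and on the direction
of `v`, and the hyperbolic cosine of its distance to `u` has the corresponding form
`exp R / 2 * a`; hence that distance is
`R + log ((a + √(a² - 4e)) / 2)` (`logCoord_expCoord_eq`). After the scaling `v = x / ε`, the number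
`e` becomes a flat function of `ε`, and everything is smooth up to `ε = 0` because there `a > 0`:
the Minkowski product of a timelike and a lightlike future vector does not vanish
(`rayPairing_zero_pos`).
-/

/-! ### Hyperbolic functions of a square root -/

/-- The entire function `s ↦ cosh √s`, given by its power series `∑ sⁿ / (2n)!`. -/
noncomputable def coshSqrt (s : ℝ) : ℝ :=
  FormalMultilinearSeries.ofScalarsSum (𝕜 := ℝ) (fun n => (((2 * n).factorial : ℝ))⁻¹) s

/-- The entire function `s ↦ sinh √s / √s`, given by its power series `∑ sⁿ / (2n + 1)!`. -/
noncomputable def sinhcSqrt (s : ℝ) : ℝ :=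
  FormalMultilinearSeries.ofScalarsSum (𝕜 := ℝ) (fun n => (((2 * n + 1).factorial : ℝ))⁻¹) s

/-- A power series whose coefficients are `1 / (φ n)!`, with `φ` strictly increasing, converges
everywhere, by the ratio test. -/
theorem hasFPowerSeriesOnBall_ofScalarsSum_inv_factorial (φ : ℕ → ℕ) (hφ : StrictMono φ) :
    HasFPowerSeriesOnBall (FormalMultilinearSeries.ofScalarsSum (𝕜 := ℝ) (E := ℝ)
      (fun n => (((φ n).factorial : ℝ))⁻¹))
      (FormalMultilinearSeries.ofScalars ℝ (fun n => (((φ n).factorial : ℝ))⁻¹)) 0 ⊤ := by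
  have hr : (FormalMultilinearSeries.ofScalars ℝ
      (fun n => (((φ n).factorial : ℝ))⁻¹)).radius = ⊤ := by
    apply FormalMultilinearSeries.ofScalars_radius_eq_top_of_tendsto
    · exact Filter.Eventually.of_forall fun n => by positivity
    · refine squeeze_zero (fun n => by positivity) (fun n => ?_)
        (tendsto_one_div_add_atTop_nhds_zero_nat (𝕜 := ℝ))
      rw [norm_inv, norm_inv, Real.norm_natCast, Real.norm_natCast, inv_div_inv,
        div_le_div_iff₀ (by positivity) (by positivity), one_mul]
      have h1 : φ n + 1 ≤ φ (n + 1) := hφ n.lt_succ_self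
      have h2 : (φ n + 1).factorial ≤ (φ (n + 1)).factorial := Nat.factorial_le h1
      rw [Nat.factorial_succ] at h2
      have h3 : n ≤ φ n := hφ.id_le n
      have h4 : (φ n).factorial * (n + 1) ≤ (φ (n + 1)).factorial := by nlinarith
      exact_mod_cast h4
  have := FormalMultilinearSeries.hasFPowerSeriesOnBall
    (FormalMultilinearSeries.ofScalars ℝ (fun n => (((φ n).factorial : ℝ))⁻¹)) (by simp [hr])
  rw [hr] at this
  exact this

theorem hasFPowerSeriesOnBall_coshSqrt : HasFPowerSeriesOnBall coshSqrt
    (FormalMultilinearSeries.ofScalars ℝ (fun n => (((2 * n).factorial : ℝ))⁻¹)) 0 ⊤ :=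
  hasFPowerSeriesOnBall_ofScalarsSum_inv_factorial (fun n => 2 * n)
    (strictMono_nat_of_lt_succ fun n => by omega)

theorem hasFPowerSeriesOnBall_sinhcSqrt : HasFPowerSeriesOnBall sinhcSqrt
    (FormalMultilinearSeries.ofScalars ℝ (fun n => (((2 * n + 1).factorial : ℝ))⁻¹)) 0 ⊤ :=
  hasFPowerSeriesOnBall_ofScalarsSum_inv_factorial (fun n => 2 * n + 1)
    (strictMono_nat_of_lt_succ fun n => by omega)

theorem contDiff_coshSqrt {n : WithTop ℕ∞} : ContDiff ℝ n coshSqrt :=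
  contDiff_iff_contDiffAt.2 fun s =>
    (hasFPowerSeriesOnBall_coshSqrt.analyticAt_of_mem (by simp)).contDiffAt

theorem contDiff_sinhcSqrt {n : WithTop ℕ∞} : ContDiff ℝ n sinhcSqrt :=
  contDiff_iff_contDiffAt.2 fun s =>
    (hasFPowerSeriesOnBall_sinhcSqrt.analyticAt_of_mem (by simp)).contDiffAt

theorem coshSqrt_sq (t : ℝ) : coshSqrt (t ^ 2) = Real.cosh t := by
  rw [Real.cosh_eq_tsum, coshSqrt, FormalMultilinearSeries.ofScalarsSum_eq_tsum]
  refine tsum_congr fun n => ?_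
  rw [← pow_mul, smul_eq_mul, div_eq_inv_mul]

theorem mul_sinhcSqrt_sq (t : ℝ) : t * sinhcSqrt (t ^ 2) = Real.sinh t := by
  rw [Real.sinh_eq_tsum, sinhcSqrt, FormalMultilinearSeries.ofScalarsSum_eq_tsum, ← tsum_mul_left]
  refine tsum_congr fun n => ?_
  rw [← pow_mul, smul_eq_mul, div_eq_inv_mul, pow_succ]
  ring

theorem sinhcSqrt_zero : sinhcSqrt 0 = 1 := by
  simp [sinhcSqrt]

theorem coshSqrt_zero : coshSqrt 0 = 1 := by
  simp [coshSqrt]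

theorem sinhcSqrt_pos {s : ℝ} (hs : 0 ≤ s) : 0 < sinhcSqrt s := by
  rcases hs.eq_or_lt with rfl | hs
  · simp [sinhcSqrt_zero]
  · have h := mul_sinhcSqrt_sq (√s)
    rw [Real.sq_sqrt hs.le] at h
    have h1 : 0 < √s := Real.sqrt_pos.2 hs
    have h2 : 0 < √s * sinhcSqrt s := h ▸ Real.sinh_pos_iff.2 h1
    exact pos_of_mul_pos_right h2 h1.le

theorem coshSqrt_eq {s : ℝ} (hs : 0 ≤ s) : coshSqrt s = Real.cosh (√s) := by
  rw [← coshSqrt_sq, Real.sq_sqrt hs]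

theorem one_le_coshSqrt {s : ℝ} (hs : 0 ≤ s) : 1 ≤ coshSqrt s := by
  rw [coshSqrt_eq hs]; exact Real.one_le_cosh _

theorem coshSqrt_sq_eq {s : ℝ} (hs : 0 ≤ s) : coshSqrt s ^ 2 = 1 + s * sinhcSqrt s ^ 2 := by
  have h := mul_sinhcSqrt_sq (√s)
  rw [Real.sq_sqrt hs] at h
  rw [coshSqrt_eq hs, Real.cosh_sq, ← h, mul_pow, Real.sq_sqrt hs]
  ring

theorem deriv_coshSqrt_ne_zero {s : ℝ} (hs : 0 ≤ s) : deriv coshSqrt s ≠ 0 := by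
  have hC : DifferentiableAt ℝ coshSqrt s :=
    (contDiff_coshSqrt (n := 1)).differentiable (by simp) s
  rcases hs.eq_or_lt with rfl | hs
  · have h := hasFPowerSeriesOnBall_coshSqrt.hasFPowerSeriesAt.hasDerivAt.deriv
    rw [h]
    simp
  · intro h0
    have h1 : HasDerivAt (fun t => coshSqrt (t ^ 2)) (deriv coshSqrt s * (2 * √s)) (√s) := by
      have h3 : HasDerivAt coshSqrt (deriv coshSqrt s) (√s ^ 2) := by
        rw [Real.sq_sqrt hs.le]; exact hC.hasDerivAt
      simpa [Function.comp_def] using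
        HasDerivAt.comp (h := fun t : ℝ => t ^ 2) (√s) h3 (hasDerivAt_pow 2 (√s))
    have h2 : HasDerivAt (fun t => coshSqrt (t ^ 2)) (Real.sinh √s) (√s) := by
      simpa only [coshSqrt_sq] using Real.hasDerivAt_cosh (√s)
    have h3 := h1.unique h2
    rw [h0, zero_mul] at h3
    exact (Real.sinh_pos_iff.2 (Real.sqrt_pos.2 hs)).ne h3

/-- The function `arcosh²` is smooth up to the boundary point `1` although `arcosh` is not: it is
the inverse of `coshSqrt`, whose derivative does not vanish on `[0, ∞)`. -/
theorem contDiffOn_arcosh_sq : ContDiffOn ℝ ∞ (fun c => Real.arcosh c ^ 2) (Set.Ici 1) := by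
  intro c hc
  have hc : 1 ≤ c := hc
  set s := Real.arcosh c ^ 2 with hs
  have hs0 : 0 ≤ s := sq_nonneg _
  have hCA : ∀ d : ℝ, 1 ≤ d → coshSqrt (Real.arcosh d ^ 2) = d := fun d hd => by
    rw [coshSqrt_sq, Real.cosh_arcosh hd]
  have hd : HasDerivAt coshSqrt (deriv coshSqrt s) s :=
    ((contDiff_coshSqrt (n := 1)).differentiable (by simp) s).hasDerivAt
  let f' : ℝ ≃L[ℝ] ℝ := ContinuousLinearEquiv.unitsEquivAut ℝ
    (Units.mk0 (deriv coshSqrt s) (deriv_coshSqrt_ne_zero hs0))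
  have hf' : HasFDerivAt coshSqrt (f' : ℝ →L[ℝ] ℝ) s := by
    have : (f' : ℝ →L[ℝ] ℝ) = ContinuousLinearMap.toSpanSingleton ℝ (deriv coshSqrt s) := by
      ext; simp [f']
    rw [this]
    exact hd.hasFDerivAt
  have hCs : ContDiffAt ℝ ∞ coshSqrt s := contDiff_coshSqrt.contDiffAt
  have hsm := hCs.to_localInverse hf' (by simp)
  set Φ := hCs.toOpenPartialHomeomorph coshSqrt hf' (by simp) with hΦ
  rw [hCA c hc] at hsm
  refine hsm.contDiffWithinAt.congr_of_eventuallyEq ?_ ?_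
  · have hcont : ContinuousWithinAt (fun d => Real.arcosh d ^ 2) (Set.Ici 1) c :=
      (Real.continuousOn_arcosh.pow 2) c hc
    have hmem : ∀ᶠ d in 𝓝[Set.Ici 1] c, Real.arcosh d ^ 2 ∈ Φ.source :=
      hcont (Φ.open_source.mem_nhds
        (hCs.mem_toOpenPartialHomeomorph_source hf' (by simp)))
    filter_upwards [hmem, self_mem_nhdsWithin] with d hd1 hd2
    have := Φ.left_inv hd1
    rw [show Φ (Real.arcosh d ^ 2) = d from hCA d hd2] at this
    exact this.symm
  · have := Φ.left_inv (hCs.mem_toOpenPartialHomeomorph_source hf' (by simp))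
    rw [show Φ s = c from hCA c hc] at this
    exact this.symm

/-- The function `c ↦ arcosh c / √(c² - 1)`, extended by its limit `1` to `c = 1`. -/
noncomputable def arcoshc (c : ℝ) : ℝ := (sinhcSqrt (Real.arcosh c ^ 2))⁻¹

theorem contDiffOn_arcoshc : ContDiffOn ℝ ∞ arcoshc (Set.Ici 1) := by
  refine ContDiffOn.inv ?_ fun c _ => (sinhcSqrt_pos (sq_nonneg _)).ne'
  exact contDiff_sinhcSqrt.comp_contDiffOn contDiffOn_arcosh_sq

theorem arcoshc_coshSqrt {s : ℝ} (hs : 0 ≤ s) : arcoshc (coshSqrt s) = (sinhcSqrt s)⁻¹ := by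
  rw [arcoshc, coshSqrt_eq hs, Real.arcosh_cosh (Real.sqrt_nonneg _), Real.sq_sqrt hs]

theorem arcoshc_eq_div {c : ℝ} (hc : 1 < c) : arcoshc c = Real.arcosh c / √(c ^ 2 - 1) := by
  have h := mul_sinhcSqrt_sq (Real.arcosh c)
  have h1 : 0 < √(c ^ 2 - 1) := Real.sqrt_pos.2 (by nlinarith)
  have h2 := sinhcSqrt_pos (sq_nonneg (Real.arcosh c))
  rw [Real.sinh_arcosh hc.le] at h
  rw [arcoshc, ← h]
  rw [← h] at h1
  have h3 : Real.arcosh c ≠ 0 := fun h0 => by simp [h0] at h1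
  field_simp

theorem arcoshc_sq_mul {c : ℝ} (hc : 1 ≤ c) :
    arcoshc c ^ 2 * (c ^ 2 - 1) = Real.arcosh c ^ 2 := by
  have h := mul_sinhcSqrt_sq (Real.arcosh c)
  have h2 := sinhcSqrt_pos (sq_nonneg (Real.arcosh c))
  rw [Real.sinh_arcosh hc] at h
  have h3 : c ^ 2 - 1 = √(c ^ 2 - 1) ^ 2 := (Real.sq_sqrt (by nlinarith)).symm
  rw [h3, ← h, arcoshc]
  field_simp

theorem coshSqrt_arcosh_sq {c : ℝ} (hc : 1 ≤ c) : coshSqrt (Real.arcosh c ^ 2) = c := by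
  rw [coshSqrt_sq, Real.cosh_arcosh hc]

/-! ### The exponential map in the graph chart -/

namespace HyperbolicPlane

/-- The height `√(1 + |u|²)` of the point of the hyperboloid above `u`. -/
noncomputable def height (u : Eucl 2) : ℝ := √(1 + u 0 ^ 2 + u 1 ^ 2)

/-- The derivative of `height` at `u` in direction `v`. -/
noncomputable def dHeight (u v : Eucl 2) : ℝ := (u 0 * v 0 + u 1 * v 1) / height u

/-- The squared Riemannian norm of the tangent vector `v` at the point above `u`. -/
noncomputable def normSq (u v : Eucl 2) : ℝ := v 0 ^ 2 + v 1 ^ 2 - dHeight u v ^ 2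

/-- The exponential map in the graph chart: the first two coordinates of
`cosh |V| • X + (sinh |V| / |V|) • V`, where `X` lies above `u` and `V` is the lift of `v`. -/
noncomputable def expCoord (u v : Eucl 2) : Eucl 2 :=
  coshSqrt (normSq u v) • u + sinhcSqrt (normSq u v) • v

/-- The hyperbolic cosine of the distance of the points above `u` and `w`. -/
noncomputable def coshDist (u w : Eucl 2) : ℝ := height u * height w - (u 0 * w 0 + u 1 * w 1)

/-- The inverse of `expCoord u`. -/
noncomputable def logCoord (u w : Eucl 2) : Eucl 2 :=
  arcoshc (coshDist u w) • (w - coshDist u w • u)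

theorem height_sq (u : Eucl 2) : height u ^ 2 = 1 + u 0 ^ 2 + u 1 ^ 2 :=
  Real.sq_sqrt (graphMap_pos u).le

theorem height_pos (u : Eucl 2) : 0 < height u := Real.sqrt_pos.2 (graphMap_pos u)

theorem height_mul_dHeight (u v : Eucl 2) : height u * dHeight u v = u 0 * v 0 + u 1 * v 1 := by
  rw [dHeight, mul_div_cancel₀ _ (height_pos u).ne']

theorem height_sq_mul_normSq (u v : Eucl 2) :
    height u ^ 2 * normSq u v = v 0 ^ 2 + v 1 ^ 2 + (u 0 * v 1 - u 1 * v 0) ^ 2 := by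
  have h : height u ^ 2 * normSq u v =
      height u ^ 2 * (v 0 ^ 2 + v 1 ^ 2) - (height u * dHeight u v) ^ 2 := by
    rw [normSq]; ring
  rw [h, height_mul_dHeight, height_sq]
  ring

theorem normSq_nonneg (u v : Eucl 2) : 0 ≤ normSq u v := by
  have h := height_sq_mul_normSq u v
  have h1 : 0 ≤ height u ^ 2 * normSq u v := by rw [h]; positivity
  exact nonneg_of_mul_nonneg_right h1 (pow_pos (height_pos u) 2)

theorem normSq_pos (u : Eucl 2) {v : Eucl 2} (hv : v ≠ 0) : 0 < normSq u v := by
  have h := height_sq_mul_normSq u v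
  have h0 : 0 < v 0 ^ 2 + v 1 ^ 2 := by
    rcases (by positivity : 0 ≤ v 0 ^ 2 + v 1 ^ 2).eq_or_lt with h0 | h0
    · refine absurd ?_ hv
      ext i
      fin_cases i <;> simp <;> nlinarith
    · exact h0
  have h1 : 0 < height u ^ 2 * normSq u v := by rw [h]; positivity
  exact pos_of_mul_pos_right h1 (sq_nonneg _)

theorem dHeight_sq_le (u v : Eucl 2) : dHeight u v ^ 2 ≤ height u ^ 2 * normSq u v := by
  rw [height_sq_mul_normSq, dHeight, div_pow, height_sq, div_le_iff₀ (graphMap_pos u)]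
  nlinarith [sq_nonneg (u 0 * v 1 - u 1 * v 0), sq_nonneg (v 0), sq_nonneg (v 1),
    mul_nonneg (add_nonneg (sq_nonneg (u 0)) (sq_nonneg (u 1))) (sq_nonneg (u 0 * v 1 - u 1 * v 0))]

theorem dHeight_smul (u v : Eucl 2) (t : ℝ) : dHeight u (t • v) = t * dHeight u v := by
  simp only [dHeight, PiLp.smul_apply, smul_eq_mul]; ring

theorem normSq_smul (u v : Eucl 2) (t : ℝ) : normSq u (t • v) = t ^ 2 * normSq u v := by
  simp only [normSq, dHeight_smul, PiLp.smul_apply, smul_eq_mul]; ring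

/-- The height of a point with `⟨x, x⟩ = -1` and `x₃ ≥ 0` is its third coordinate. -/
theorem height_eq_of_sq {w : Eucl 2} {x : ℝ} (hx : 0 ≤ x) (h : x ^ 2 = 1 + w 0 ^ 2 + w 1 ^ 2) :
    height w = x := by
  rw [height, ← h, Real.sqrt_sq hx]

/-- If `cc² = 1 + |v|² ss²`, then `cc • X + ss • V` lies on the hyperboloid. -/
theorem height_combination (u v : Eucl 2) {cc ss : ℝ} (hcc : 0 ≤ cc)
    (h : cc ^ 2 = 1 + normSq u v * ss ^ 2) :
    height (cc • u + ss • v) = cc * height u + ss * dHeight u v := by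
  have h1 := height_sq u
  have h2 := height_mul_dHeight u v
  have h3 := dHeight_sq_le u v
  apply height_eq_of_sq
  · have h4 : (ss * dHeight u v) ^ 2 ≤ (cc * height u) ^ 2 := by
      have := mul_le_mul_of_nonneg_left h3 (sq_nonneg ss)
      have h5 := pow_pos (height_pos u) 2
      rw [mul_pow, mul_pow, h]
      nlinarith
    have := sq_le_sq.1 h4
    rw [abs_of_nonneg (mul_nonneg hcc (height_pos u).le)] at this
    linarith [neg_le_of_abs_le this]
  · simp only [PiLp.add_apply, PiLp.smul_apply, smul_eq_mul]
    rw [normSq] at h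
    linear_combination cc ^ 2 * h1 + 2 * cc * ss * h2 + h

theorem expCoord_hyperbola (u v : Eucl 2) :
    coshSqrt (normSq u v) ^ 2 = 1 + normSq u v * sinhcSqrt (normSq u v) ^ 2 :=
  coshSqrt_sq_eq (normSq_nonneg u v)

theorem height_expCoord (u v : Eucl 2) : height (expCoord u v) =
    coshSqrt (normSq u v) * height u + sinhcSqrt (normSq u v) * dHeight u v :=
  height_combination u v (zero_le_one.trans (one_le_coshSqrt (normSq_nonneg u v)))
    (expCoord_hyperbola u v)

theorem coshDist_expCoord (u v : Eucl 2) : coshDist u (expCoord u v) = coshSqrt (normSq u v) := by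
  have h1 := height_sq u
  have h2 := height_mul_dHeight u v
  rw [coshDist, height_expCoord]
  simp only [expCoord, PiLp.add_apply, PiLp.smul_apply, smul_eq_mul]
  linear_combination coshSqrt (normSq u v) * h1 + sinhcSqrt (normSq u v) * h2

theorem logCoord_expCoord (u v : Eucl 2) : logCoord u (expCoord u v) = v := by
  rw [logCoord, coshDist_expCoord, expCoord, add_sub_cancel_left,
    arcoshc_coshSqrt (normSq_nonneg u v), smul_smul,
    inv_mul_cancel₀ (sinhcSqrt_pos (normSq_nonneg u v)).ne', one_smul]

theorem one_le_coshDist (u w : Eucl 2) : 1 ≤ coshDist u w := by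
  have h : (1 + (u 0 * w 0 + u 1 * w 1)) ^ 2 ≤ (height u * height w) ^ 2 := by
    rw [mul_pow, height_sq, height_sq]
    nlinarith [sq_nonneg (u 0 - w 0), sq_nonneg (u 1 - w 1), sq_nonneg (u 0 * w 1 - u 1 * w 0)]
  have := abs_le_of_sq_le_sq h (mul_nonneg (height_pos u).le (height_pos w).le)
  rw [coshDist]
  linarith [le_of_abs_le this]

theorem normSq_sub_coshDist_smul (u w : Eucl 2) :
    normSq u (w - coshDist u w • u) = coshDist u w ^ 2 - 1 := by
  have hc : coshDist u w = height u * height w - (u 0 * w 0 + u 1 * w 1) := rfl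
  have hd : dHeight u (w - coshDist u w • u) = height w - coshDist u w * height u := by
    rw [dHeight, div_eq_iff (height_pos u).ne']
    simp only [PiLp.sub_apply, PiLp.smul_apply, smul_eq_mul]
    linear_combination coshDist u w * height_sq u + hc
  rw [normSq, hd]
  simp only [PiLp.sub_apply, PiLp.smul_apply, smul_eq_mul]
  linear_combination (-1) * height_sq w - coshDist u w ^ 2 * height_sq u -
    2 * coshDist u w * hc

theorem expCoord_logCoord (u w : Eucl 2) : expCoord u (logCoord u w) = w := by
  have hc := one_le_coshDist u w
  have hn : normSq u (logCoord u w) = Real.arcosh (coshDist u w) ^ 2 := by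
    rw [logCoord, normSq_smul, normSq_sub_coshDist_smul, arcoshc_sq_mul hc]
  rw [expCoord, hn, coshSqrt_arcosh_sq hc, logCoord, smul_smul, arcoshc,
    mul_inv_cancel₀ (sinhcSqrt_pos (sq_nonneg _)).ne', one_smul, add_sub_cancel]

theorem contDiff_height {n : WithTop ℕ∞} : ContDiff ℝ n height := by
  unfold height
  exact ContDiff.sqrt (by fun_prop) fun u => (graphMap_pos u).ne'

theorem contDiff_normSq {n : WithTop ℕ∞} :
    ContDiff ℝ n (fun p : Eucl 2 × Eucl 2 => normSq p.1 p.2) := by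
  unfold normSq dHeight
  have h : ContDiff ℝ n (fun p : Eucl 2 × Eucl 2 =>
      (p.1 0 * p.2 0 + p.1 1 * p.2 1) / height p.1) :=
    ContDiff.div (by fun_prop) (contDiff_height.comp contDiff_fst) fun p => (height_pos _).ne'
  exact ContDiff.sub (by fun_prop) (h.pow 2)

theorem contDiff_expCoord {n : WithTop ℕ∞} :
    ContDiff ℝ n (fun p : Eucl 2 × Eucl 2 => expCoord p.1 p.2) :=
  ((contDiff_coshSqrt.comp contDiff_normSq).smul contDiff_fst).add
    ((contDiff_sinhcSqrt.comp contDiff_normSq).smul contDiff_snd)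

theorem contDiff_normSq_right (u : Eucl 2) {n : WithTop ℕ∞} : ContDiff ℝ n (normSq u) :=
  contDiff_normSq.comp (f := fun v : Eucl 2 => (u, v)) (by fun_prop)

theorem contDiff_expCoord_right (u : Eucl 2) {n : WithTop ℕ∞} : ContDiff ℝ n (expCoord u) :=
  contDiff_expCoord.comp (f := fun v : Eucl 2 => (u, v)) (by fun_prop)

theorem contDiff_coshDist (u : Eucl 2) {n : WithTop ℕ∞} : ContDiff ℝ n (coshDist u) :=
  (contDiff_const.mul contDiff_height).sub (by fun_prop)

theorem contDiff_logCoord (u : Eucl 2) : ContDiff ℝ ∞ (logCoord u) := by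
  have h : ContDiff ℝ ∞ (fun w => arcoshc (coshDist u w)) :=
    contDiffOn_arcoshc.comp_contDiff (contDiff_coshDist u) (one_le_coshDist u)
  exact h.smul (contDiff_id.sub ((contDiff_coshDist u).smul contDiff_const))

end HyperbolicPlane

/-! ### Symbol estimates from a smooth extension to infinity -/

section Symbol

variable {n : ℕ} {G : Type*} [NormedAddCommGroup G] [NormedSpace ℝ G]

/-- A property that is preserved by all partial derivatives is preserved by `∂^α`; the relation
may keep track of the number of derivatives taken. -/
theorem multiDeriv_induction {H : Type*} {f : H → Eucl n → G} (P : ℕ → (H → Eucl n → G) → Prop)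
    (hP : ∀ k g, P k g → ∀ i, P (k + 1) (fun a => pderiv i (g a))) (hf : P 0 f)
    (α : Fin n → ℕ) : P (∑ i, α i) (fun a => multiDeriv α (f a)) := by
  have iter : ∀ (i : Fin n) (m k : ℕ) (g : H → Eucl n → G), P k g →
      P (k + m) (fun a => (pderiv i)^[m] (g a)) := by
    intro i m
    induction m with
    | zero => intro k g hg; exact hg
    | succ m ih =>
      intro k g hg
      simp only [Function.iterate_succ_apply']
      exact hP _ _ (ih k g hg) i
  have fold : ∀ l : List (Fin n), P (l.map α).sum
      (fun a => l.foldr (fun i g => (pderiv i)^[α i] g) (f a)) := by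
    intro l
    induction l with
    | nil => exact hf
    | cons i l ih =>
      simp only [List.foldr_cons, List.map_cons, List.sum_cons]
      rw [add_comm]
      exact iter i (α i) _ _ ih
  have h := fold (List.finRange n)
  rwa [← Fin.sum_univ_def] at h

theorem multiDeriv_smul_comp_smul (c d : ℝ) (f : Eucl n → G) (α : Fin n → ℕ) (x : Eucl n) :
    multiDeriv α (fun y => c • f (d • y)) x =
      (c * d ^ (∑ i, α i)) • multiDeriv α f (d • x) := by
  have h := multiDeriv_induction (H := Bool)
    (f := fun b => cond b (fun y => c • f (d • y)) f)
    (fun k g => ∀ x, g true x = (c * d ^ k) • g false (d • x)) ?_ ?_ α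
  · exact h x
  · intro k g hg i x
    have e : g true = (c * d ^ k) • fun x => g false (d • x) := funext hg
    have e2 : fderiv ℝ (fun x => g false (d • x)) x = d • fderiv ℝ (g false) (d • x) :=
      fderiv_comp_smul _
    simp only [pderiv]
    rw [e, fderiv_const_smul_field, Pi.smul_apply, e2]
    simp only [smul_apply, smul_smul, pow_succ, mul_assoc]
  · intro x
    simp

theorem multiDeriv_congr {f g : Eucl n → G} {x : Eucl n} (h : f =ᶠ[𝓝 x] g) (α : Fin n → ℕ) :
    multiDeriv α f x = multiDeriv α g x := by
  have h := multiDeriv_induction (H := Bool) (f := fun b => cond b f g)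
    (fun _ F => F true =ᶠ[𝓝 x] F false) ?_ h α
  · exact h.eq_of_nhds
  · intro k F hF i
    filter_upwards [Filter.EventuallyEq.fderiv (𝕜 := ℝ) hF] with y hy
    simp only [pderiv, hy]

/-- The partial derivatives `∂_x^α F(ε, x)` of a jointly smooth function are jointly smooth. -/
theorem contDiffAt_multiDeriv {F : ℝ → Eucl n → G} {p : ℝ × Eucl n}
    (hF : ContDiffAt ℝ ∞ (fun q : ℝ × Eucl n => F q.1 q.2) p) (α : Fin n → ℕ) :
    ContDiffAt ℝ ∞ (fun q : ℝ × Eucl n => multiDeriv α (F q.1) q.2) p := by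
  refine multiDeriv_induction (f := F)
    (fun _ F => ContDiffAt ℝ ∞ (fun q : ℝ × Eucl n => F q.1 q.2) p) ?_ hF α
  intro k F hF i
  have h1 : ContDiffAt ℝ ∞ (fderiv ℝ (fun q : ℝ × Eucl n => F q.1 q.2)) p :=
    hF.fderiv_right (by simp)
  have h2 : ContDiffAt ℝ ∞ (fun q => fderiv ℝ (fun q : ℝ × Eucl n => F q.1 q.2) q
      ((0 : ℝ), (EuclideanSpace.single i 1 : Eucl n))) p := h1.clm_apply contDiffAt_const
  refine h2.congr_of_eventuallyEq ?_
  have h3 : ∀ᶠ q in 𝓝 p, ContDiffAt ℝ 1 (fun q : ℝ × Eucl n => F q.1 q.2) q :=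
    (hF.of_le (by simp)).eventually (by simp)
  filter_upwards [h3] with q hq
  have h4 := (hq.differentiableAt (by simp)).hasFDerivAt.comp q.2
    (hasFDerivAt_prodMk_right (𝕜 := ℝ) q.1 q.2)
  have h5 : fderiv ℝ (F q.1) q.2 = _ := h4.fderiv
  simp only [pderiv, h5]
  simp

theorem continuous_multiDeriv {f : Eucl n → G} (hf : ContDiff ℝ ∞ f) (α : Fin n → ℕ) :
    Continuous (multiDeriv α f) := by
  refine continuous_iff_continuousAt.2 fun x => ?_
  have h : ContDiffAt ℝ ∞ (fun q : ℝ × Eucl n => multiDeriv α f q.2) (0, x) :=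
    contDiffAt_multiDeriv (F := fun _ => f) (hf.comp contDiff_snd).contDiffAt α
  exact ContinuousAt.comp (f := fun y : Eucl n => ((0 : ℝ), y)) h.continuousAt (by fun_prop)

theorem one_le_japaneseBracket (x : Eucl n) : 1 ≤ japaneseBracket x := by
  rw [japaneseBracket, Real.one_le_sqrt]
  nlinarith [norm_nonneg x]

theorem norm_le_japaneseBracket (x : Eucl n) : ‖x‖ ≤ japaneseBracket x :=
  Real.le_sqrt_of_sq_le (by linarith)

theorem japaneseBracket_le {x : Eucl n} (hx : 1 ≤ ‖x‖) : japaneseBracket x ≤ 2 * ‖x‖ := by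
  rw [japaneseBracket]
  exact Real.sqrt_le_iff.2 ⟨by positivity, by nlinarith⟩

theorem continuous_japaneseBracket : Continuous (japaneseBracket (n := n)) := by
  unfold japaneseBracket
  fun_prop

/-- Estimates of a function on `{ε > 0} × K` near each point of `{0} × K` combine to a uniform
estimate, by compactness of `K`. -/
theorem exists_bound_of_isCompact {Y : Type*} [TopologicalSpace Y] {K : Set Y} (hK : IsCompact K)
    {f : ℝ → Y → ℝ} (h : ∀ y ∈ K, ∃ C, ∀ᶠ q : ℝ × Y in 𝓝 (0, y), 0 < q.1 → f q.1 q.2 ≤ C) :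
    ∃ C, ∀ᶠ ε in 𝓝 (0 : ℝ), ∀ y ∈ K, 0 < ε → f ε y ≤ C := by
  refine hK.induction_on (p := fun s => ∃ C, ∀ᶠ ε in 𝓝 (0 : ℝ), ∀ y ∈ s, 0 < ε → f ε y ≤ C)
    ⟨0, by simp⟩ ?_ ?_ ?_
  · rintro s t hst ⟨C, hC⟩
    exact ⟨C, hC.mono fun ε h y hy => h y (hst hy)⟩
  · rintro s t ⟨C, hC⟩ ⟨D, hD⟩
    refine ⟨max C D, ?_⟩
    filter_upwards [hC, hD] with ε h1 h2 y hy hε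
    rcases hy with hy | hy
    · exact (h1 y hy hε).trans (le_max_left _ _)
    · exact (h2 y hy hε).trans (le_max_right _ _)
  · intro y hy
    obtain ⟨C, hC⟩ := h y hy
    rw [nhds_prod_eq, Filter.eventually_prod_iff] at hC
    obtain ⟨pa, ha, pb, hb, hab⟩ := hC
    exact ⟨{z | pb z}, mem_nhdsWithin_of_mem_nhds hb, C, ha.mono fun ε h z hz => hab h hz⟩

/-- A function `f` on `ℝⁿ` satisfies symbol estimates of order one if `ε f(x / ε)`, defined for
`ε > 0`, extends smoothly across `ε = 0` near the unit sphere: the derivative `∂_x^α` of the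
extension is bounded for `|x| = 1` and small `ε`, and equals `ε^(1 - |α|) (∂^α f)(x / ε)`. -/
theorem exists_symbol_bound {f : Eucl n → G} (hf : ContDiff ℝ ∞ f) {F : ℝ → Eucl n → G}
    (hF : ∀ x : Eucl n, ‖x‖ = 1 → ContDiffAt ℝ ∞ (fun q : ℝ × Eucl n => F q.1 q.2) (0, x))
    (hFf : ∀ x : Eucl n, ‖x‖ = 1 → ∀ᶠ q : ℝ × Eucl n in 𝓝 (0, x),
      0 < q.1 → F q.1 q.2 = q.1 • f (q.1⁻¹ • q.2)) (α : Fin n → ℕ) :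
    ∃ C : ℝ, ∀ x : Eucl n, ‖multiDeriv α f x‖ ≤
      C * japaneseBracket x ^ (-1 * (((∑ i, α i : ℕ) : ℝ) - 1)) := by
  set k := ∑ i, α i with hk
  have hloc : ∀ x ∈ Metric.sphere (0 : Eucl n) 1, ∃ C, ∀ᶠ q : ℝ × Eucl n in 𝓝 (0, x),
      0 < q.1 → ‖(q.1 * q.1⁻¹ ^ k) • multiDeriv α f (q.1⁻¹ • q.2)‖ ≤ C := by
    intro x hx
    have hx : ‖x‖ = 1 := by simpa using hx
    have hc := (contDiffAt_multiDeriv (hF x hx) α).continuousAt.norm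
    refine ⟨‖multiDeriv α (F 0) x‖ + 1, ?_⟩
    filter_upwards [hc.eventually_lt_const (lt_add_one _), (hFf x hx).eventually_nhds]
      with q hq1 hq2 hq
    have h1 : F q.1 =ᶠ[𝓝 q.2] fun y => q.1 • f (q.1⁻¹ • y) := by
      have h2 : Filter.Tendsto (fun y => (q.1, y)) (𝓝 q.2) (𝓝 q) := by
        have : Continuous (fun y : Eucl n => (q.1, y)) := by fun_prop
        exact this.tendsto q.2
      filter_upwards [h2.eventually hq2] with y hy using hy hq
    rw [hk, ← multiDeriv_smul_comp_smul, ← multiDeriv_congr h1]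
    exact hq1.le
  obtain ⟨C, hC⟩ := exists_bound_of_isCompact (isCompact_sphere (0 : Eucl n) 1)
    (f := fun ε y => ‖(ε * ε⁻¹ ^ k) • multiDeriv α f (ε⁻¹ • y)‖) hloc
  obtain ⟨δ, hδ, hδC⟩ := Metric.eventually_nhds_iff.1 hC
  have hpow : ∀ x : Eucl n, japaneseBracket x ^ (-1 * ((k : ℝ) - 1)) =
      japaneseBracket x / japaneseBracket x ^ k := by
    intro x
    have h0 : 0 < japaneseBracket x := one_pos.trans_le (one_le_japaneseBracket x)
    rw [show (-1 * ((k : ℝ) - 1)) = 1 - k by ring, Real.rpow_sub h0, Real.rpow_one,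
      Real.rpow_natCast]
  set R := max 1 (2 / δ) with hR
  have hcont : Continuous fun x : Eucl n =>
      ‖multiDeriv α f x‖ * japaneseBracket x ^ k := by
    exact (continuous_multiDeriv hf α).norm.mul (continuous_japaneseBracket.pow k)
  obtain ⟨D, hD⟩ := (isCompact_closedBall (0 : Eucl n) R).bddAbove_image hcont.continuousOn
  refine ⟨max D (2 ^ k * C), fun x => ?_⟩
  have h1 := one_le_japaneseBracket x
  have h0 : 0 < japaneseBracket x := one_pos.trans_le h1
  rw [hpow, ← mul_div_assoc, le_div_iff₀ (pow_pos h0 k)]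
  rcases le_or_gt ‖x‖ R with hx | hx
  · have hDx : ‖multiDeriv α f x‖ * japaneseBracket x ^ k ≤ D :=
      hD ⟨x, by simpa using hx, rfl⟩
    have hD0 : 0 ≤ D := le_trans (by positivity) hDx
    calc _ ≤ D := hDx
      _ ≤ max D (2 ^ k * C) := le_max_left _ _
      _ ≤ max D (2 ^ k * C) * japaneseBracket x :=
        le_mul_of_one_le_right (hD0.trans (le_max_left _ _)) h1
  · have hx1 : 1 ≤ ‖x‖ := (le_max_left _ _).trans hx.le
    have hx0 : 0 < ‖x‖ := one_pos.trans_le hx1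
    have hxδ : ‖x‖⁻¹ < δ := by
      have : 2 / δ < ‖x‖ := (le_max_right _ _).trans_lt hx
      rw [div_lt_iff₀ hδ] at this
      rw [inv_lt_iff_one_lt_mul₀ hx0]
      linarith
    have h2 := hδC (y := ‖x‖⁻¹) (by simpa using hxδ) (‖x‖⁻¹ • x)
      (by simp [norm_smul, hx0.ne']) (inv_pos.2 hx0)
    rw [inv_inv, smul_smul, mul_inv_cancel₀ hx0.ne', one_smul, norm_smul, Real.norm_of_nonneg
      (by positivity), mul_assoc, inv_mul_le_iff₀ hx0] at h2
    have hC0 : 0 ≤ C := by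
      have : 0 ≤ ‖x‖ * C := le_trans (by positivity) h2
      exact nonneg_of_mul_nonneg_right this hx0
    calc ‖multiDeriv α f x‖ * japaneseBracket x ^ k
        ≤ ‖multiDeriv α f x‖ * (2 * ‖x‖) ^ k := by
          gcongr
          exact japaneseBracket_le hx1
      _ = 2 ^ k * (‖x‖ ^ k * ‖multiDeriv α f x‖) := by rw [mul_pow]; ring
      _ ≤ 2 ^ k * (‖x‖ * C) := by gcongr
      _ = 2 ^ k * C * ‖x‖ := by ring
      _ ≤ max D (2 ^ k * C) * japaneseBracket x := by
          gcongr
          · exact le_max_right _ _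
          · exact norm_le_japaneseBracket x

end Symbol

/-! ### The asymptotics of a normal coordinate change -/

namespace HyperbolicPlane

/-- The Riemannian norm of the tangent vector `v` at the point above `u`. -/
noncomputable def rNorm (u v : Eucl 2) : ℝ := √(normSq u v)

/-- With `e = exp (-2|v|)`, the point `exp_u v` is `(exp |v| / 2) • q`, where `q` has these first
two coordinates. For `e = 0`, `q` is a lightlike vector, the point at infinity of the ray in
direction `v`. -/
noncomputable def rayVec (u : Eucl 2) (e : ℝ) (v : Eucl 2) : Eucl 2 :=
  (1 + e) • u + ((1 - e) / rNorm u v) • v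

/-- The third coordinate of the vector described at `rayVec`. -/
noncomputable def rayHeight (u : Eucl 2) (e : ℝ) (v : Eucl 2) : ℝ :=
  (1 + e) * height u + (1 - e) / rNorm u v * dHeight u v

/-- The negative of the Minkowski product of the point above `u` with the vector described at
`rayVec`, for the ray of `v` at `u'`. -/
noncomputable def rayPairing (u u' : Eucl 2) (e : ℝ) (v : Eucl 2) : ℝ :=
  height u * rayHeight u' e v - (u 0 * rayVec u' e v 0 + u 1 * rayVec u' e v 1)

theorem rNorm_pos (u : Eucl 2) {v : Eucl 2} (hv : v ≠ 0) : 0 < rNorm u v :=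
  Real.sqrt_pos.2 (normSq_pos u hv)

theorem rNorm_sq (u v : Eucl 2) : rNorm u v ^ 2 = normSq u v := Real.sq_sqrt (normSq_nonneg u v)

theorem rNorm_smul (u v : Eucl 2) {t : ℝ} (ht : 0 ≤ t) : rNorm u (t • v) = t * rNorm u v := by
  rw [rNorm, normSq_smul, Real.sqrt_mul (sq_nonneg t), Real.sqrt_sq ht, rNorm]

theorem rayVec_smul (u : Eucl 2) (e : ℝ) (v : Eucl 2) {t : ℝ} (ht : 0 < t) :
    rayVec u e (t • v) = rayVec u e v := by
  rw [rayVec, rayVec, rNorm_smul u v ht.le, smul_smul, mul_comm t, ← div_div,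
    div_mul_cancel₀ _ ht.ne']

theorem rayHeight_smul (u : Eucl 2) (e : ℝ) (v : Eucl 2) {t : ℝ} (ht : 0 < t) :
    rayHeight u e (t • v) = rayHeight u e v := by
  rw [rayHeight, rayHeight, rNorm_smul u v ht.le, dHeight_smul, mul_comm t (rNorm u v), ← div_div,
    ← mul_assoc, div_mul_cancel₀ _ ht.ne']

theorem rayPairing_smul (u u' : Eucl 2) (e : ℝ) (v : Eucl 2) {t : ℝ} (ht : 0 < t) :
    rayPairing u u' e (t • v) = rayPairing u u' e v := by
  rw [rayPairing, rayPairing, rayVec_smul _ _ _ ht, rayHeight_smul _ _ _ ht]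

theorem coshSqrt_normSq (u v : Eucl 2) : coshSqrt (normSq u v) =
    Real.exp (rNorm u v) / 2 * (1 + Real.exp (-2 * rNorm u v)) := by
  rw [coshSqrt_eq (normSq_nonneg u v), ← rNorm, Real.cosh_eq, mul_add, mul_one, div_mul_eq_mul_div,
    ← Real.exp_add]
  ring_nf

theorem sinhcSqrt_normSq (u : Eucl 2) {v : Eucl 2} (hv : v ≠ 0) : sinhcSqrt (normSq u v) =
    Real.exp (rNorm u v) / 2 * ((1 - Real.exp (-2 * rNorm u v)) / rNorm u v) := by
  have h0 := rNorm_pos u hv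
  have h := mul_sinhcSqrt_sq (rNorm u v)
  rw [rNorm_sq] at h
  rw [← mul_div_assoc, eq_div_iff h0.ne', mul_comm, h, Real.sinh_eq, mul_sub, mul_one,
    div_mul_eq_mul_div, ← Real.exp_add]
  ring_nf

theorem expCoord_eq_rayVec (u : Eucl 2) {v : Eucl 2} (hv : v ≠ 0) : expCoord u v =
    (Real.exp (rNorm u v) / 2) • rayVec u (Real.exp (-2 * rNorm u v)) v := by
  rw [expCoord, coshSqrt_normSq, sinhcSqrt_normSq u hv, rayVec, smul_add, smul_smul, smul_smul]

theorem height_expCoord_eq_rayHeight (u : Eucl 2) {v : Eucl 2} (hv : v ≠ 0) :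
    height (expCoord u v) =
      Real.exp (rNorm u v) / 2 * rayHeight u (Real.exp (-2 * rNorm u v)) v := by
  rw [height_expCoord, coshSqrt_normSq, sinhcSqrt_normSq u hv, rayHeight]
  ring

theorem coshDist_eq_rayPairing (u u' : Eucl 2) {v : Eucl 2} (hv : v ≠ 0) :
    coshDist u (expCoord u' v) =
      Real.exp (rNorm u' v) / 2 * rayPairing u u' (Real.exp (-2 * rNorm u' v)) v := by
  rw [coshDist, height_expCoord_eq_rayHeight u' hv, expCoord_eq_rayVec u' hv, rayPairing]
  simp only [PiLp.smul_apply, smul_eq_mul]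
  ring

/-- The normal coordinate change at infinity: it is the product of a function `|v| + O(1)` and a
vector, both depending smoothly on `exp (-2|v|)` and on the direction of `v`. -/
theorem logCoord_expCoord_eq (u u' : Eucl 2) {v : Eucl 2} (hv : v ≠ 0) {e a D : ℝ}
    (he : e = Real.exp (-2 * rNorm u' v)) (ha : a = rayPairing u u' e v) (hD : D = a ^ 2 - 4 * e)
    (ha0 : 0 < a) (hD0 : 0 < D) :
    logCoord u (expCoord u' v) =
      ((rNorm u' v + Real.log ((a + √D) / 2)) / √D) • (rayVec u' e v - a • u) := by
  have hw := expCoord_eq_rayVec u' hv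
  have hc := coshDist_eq_rayPairing u u' hv
  rw [← he] at hw hc
  rw [← ha] at hc
  set R := rNorm u' v
  set c := coshDist u (expCoord u' v)
  have hE := Real.exp_pos R
  have hEe : Real.exp R ^ 2 * e = 1 := by
    rw [he, ← Real.exp_nat_mul, ← Real.exp_add]
    simp
  have hsq : c ^ 2 - 1 = (Real.exp R / 2) ^ 2 * D := by
    rw [hc, hD]
    linear_combination hEe
  have hc1 : 1 < c := by
    have h1 : 0 < c ^ 2 - 1 := by rw [hsq]; positivity
    have h2 : 0 < c := by rw [hc]; positivity
    nlinarith
  have hs : √(c ^ 2 - 1) = Real.exp R / 2 * √D := by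
    rw [hsq, Real.sqrt_mul (sq_nonneg _), Real.sqrt_sq (by positivity)]
  have hlog : Real.arcosh c = R + Real.log ((a + √D) / 2) := by
    rw [Real.arcosh, hs, hc, ← mul_add, div_mul_eq_mul_div, mul_div_assoc,
      Real.log_mul hE.ne' (by positivity), Real.log_exp]
  have hv2 : expCoord u' v - c • u = (Real.exp R / 2) • (rayVec u' e v - a • u) := by
    rw [hw, hc, smul_sub, smul_smul]
  have hsD : 0 < √D := Real.sqrt_pos.2 hD0
  rw [logCoord, hv2, smul_smul]
  congr 1
  change arcoshc c * _ = _
  rw [arcoshc_eq_div hc1, hs, hlog]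
  field_simp

/-- The scalar product of a future timelike and a future lightlike vector does not vanish. -/
theorem rayPairing_zero_pos (u u' : Eucl 2) {v : Eucl 2} (hv : v ≠ 0) :
    0 < rayPairing u u' 0 v := by
  obtain ⟨w, hw, hwn⟩ : ∃ w : Eucl 2, w = (rNorm u' v)⁻¹ • v ∧ normSq u' w = 1 := by
    refine ⟨_, rfl, ?_⟩
    rw [normSq_smul, ← rNorm_sq, inv_pow, inv_mul_cancel₀ (pow_pos (rNorm_pos u' hv) 2).ne']
  have hq : rayVec u' 0 v = u' + w := by simp [rayVec, hw]
  have hq3 : rayHeight u' 0 v = height u' + dHeight u' w := by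
    simp [rayHeight, hw, dHeight_smul]
  have h1 := height_sq_mul_normSq u' w
  have h2 := height_mul_dHeight u' w
  have h3 := height_sq u'
  have h4 := height_pos u'
  have hn : w 0 ^ 2 + w 1 ^ 2 = 1 + dHeight u' w ^ 2 := by
    rw [normSq] at hwn; linarith
  have hpos : 0 < height u' + dHeight u' w := by
    rw [hwn, hn] at h1
    have h5 : dHeight u' w ^ 2 < height u' ^ 2 := by
      nlinarith [sq_nonneg (u' 0 * w 1 - u' 1 * w 0)]
    have := (abs_lt_of_sq_lt_sq' h5 h4.le).1
    linarith
  have hnull : (u' 0 + w 0) ^ 2 + (u' 1 + w 1) ^ 2 = (height u' + dHeight u' w) ^ 2 := by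
    linear_combination hn - h3 - 2 * h2
  rw [rayPairing, hq, hq3]
  simp only [PiLp.add_apply]
  have hlt : (u 0 * (u' 0 + w 0) + u 1 * (u' 1 + w 1)) ^ 2 <
      (height u * (height u' + dHeight u' w)) ^ 2 := by
    rw [mul_pow, ← hnull, height_sq]
    have : 0 < (u' 0 + w 0) ^ 2 + (u' 1 + w 1) ^ 2 := by rw [hnull]; positivity
    nlinarith [sq_nonneg (u 0 * (u' 1 + w 1) - u 1 * (u' 0 + w 0))]
  have := (abs_lt_of_sq_lt_sq' hlt (mul_nonneg (height_pos u).le hpos.le)).2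
  linarith

/-- The normal coordinate change, written in linear coordinates, satisfies symbol estimates of
order one. -/
theorem exists_bound_logCoord_expCoord (u u' : Eucl 2) (A : Eucl 2 →L[ℝ] Eucl 2)
    (B : Eucl 2 ≃L[ℝ] Eucl 2) (α : Fin 2 → ℕ) :
    ∃ C : ℝ, ∀ x : Eucl 2, ‖multiDeriv α (fun x => A (logCoord u (expCoord u' (B x)))) x‖ ≤
      C * japaneseBracket x ^ (-1 * (((∑ i, α i : ℕ) : ℝ) - 1)) := by
  have hsmooth : ContDiff ℝ ∞ (fun x => A (logCoord u (expCoord u' (B x)))) :=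
    A.contDiff.comp ((contDiff_logCoord u).comp
      ((contDiff_expCoord_right u').comp B.contDiff))
  let ρ : Eucl 2 → ℝ := fun x => rNorm u' (B x)
  -- the smooth extension of `exp (-2 ρ x / ε)` by zero to `ε ≤ 0`
  let e : ℝ × Eucl 2 → ℝ := fun q => expNegInvGlue (q.1 / (2 * ρ q.2))
  let a : ℝ × Eucl 2 → ℝ := fun q => rayPairing u u' (e q) (B q.2)
  let D : ℝ × Eucl 2 → ℝ := fun q => a q ^ 2 - 4 * e q
  let F : ℝ → Eucl 2 → Eucl 2 := fun ε x =>
    A (((ρ x + ε * Real.log ((a (ε, x) + √(D (ε, x))) / 2)) / √(D (ε, x))) •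
      (rayVec u' (e (ε, x)) (B x) - a (ε, x) • u))
  have hB : ∀ x : Eucl 2, ‖x‖ = 1 → B x ≠ 0 := fun x hx h0 => by
    rw [map_eq_zero_iff B B.injective] at h0
    simp [h0] at hx
  have he0 : ∀ x, e (0, x) = 0 := fun x => by simp [e]
  have hae : ∀ x : Eucl 2, ‖x‖ = 1 → ContDiffAt ℝ ∞ ρ x ∧ ContDiffAt ℝ ∞ e (0, x) ∧
      ContDiffAt ℝ ∞ (fun q : ℝ × Eucl 2 => rayVec u' (e q) (B q.2)) (0, x) ∧
      ContDiffAt ℝ ∞ a (0, x) ∧ 0 < a (0, x) ∧ 0 < D (0, x) := by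
    intro x hx
    have hBx := hB x hx
    have hρ : ContDiffAt ℝ ∞ ρ x := by
      have h1 : ContDiff ℝ ∞ (fun x => normSq u' (B x)) :=
        (contDiff_normSq_right u').comp B.contDiff
      exact h1.contDiffAt.sqrt (normSq_pos u' hBx).ne'
    have hρ0 : ρ x ≠ 0 := (rNorm_pos u' hBx).ne'
    have hρ2 : ContDiffAt ℝ ∞ (fun q : ℝ × Eucl 2 => ρ q.2) (0, x) :=
      ContDiffAt.comp (g := ρ) (0, x) hρ contDiffAt_snd
    have he : ContDiffAt ℝ ∞ e (0, x) := by
      have h1 : ContDiffAt ℝ ∞ (fun q : ℝ × Eucl 2 => q.1 / (2 * ρ q.2)) (0, x) :=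
        contDiffAt_fst.div (contDiffAt_const.mul hρ2) (by simpa using hρ0)
      exact expNegInvGlue.contDiff.contDiffAt.comp _ h1
    have hB2 : ContDiffAt ℝ ∞ (fun q : ℝ × Eucl 2 => B q.2) (0, x) :=
      (B.contDiff.comp contDiff_snd).contDiffAt
    have hcoef : ContDiffAt ℝ ∞ (fun q : ℝ × Eucl 2 => (1 - e q) / ρ q.2) (0, x) :=
      (contDiffAt_const.sub he).div hρ2 hρ0
    have hvec : ContDiffAt ℝ ∞ (fun q : ℝ × Eucl 2 => rayVec u' (e q) (B q.2)) (0, x) :=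
      ((contDiffAt_const.add he).smul contDiffAt_const).add (hcoef.smul hB2)
    have hdh : ContDiffAt ℝ ∞ (fun q : ℝ × Eucl 2 => dHeight u' (B q.2)) (0, x) := by
      have h1 : ContDiff ℝ ∞ (fun v : Eucl 2 => dHeight u' v) := by
        unfold dHeight
        exact ContDiff.div_const (by fun_prop) _
      exact h1.contDiffAt.comp _ hB2
    have hht : ContDiffAt ℝ ∞ (fun q : ℝ × Eucl 2 => rayHeight u' (e q) (B q.2)) (0, x) :=
      ((contDiffAt_const.add he).mul contDiffAt_const).add (hcoef.mul hdh)
    have hvi : ∀ i, ContDiffAt ℝ ∞ (fun q : ℝ × Eucl 2 => rayVec u' (e q) (B q.2) i) (0, x) :=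
      fun i => (contDiffAt_piLp 2).1 hvec i
    have ha : ContDiffAt ℝ ∞ a (0, x) :=
      (contDiffAt_const.mul hht).sub
        ((contDiffAt_const.mul (hvi 0)).add (contDiffAt_const.mul (hvi 1)))
    have ha0 : 0 < a (0, x) := by
      simp only [a, he0]
      exact rayPairing_zero_pos u u' hBx
    refine ⟨hρ, he, hvec, ha, ha0, ?_⟩
    simp only [D, he0, mul_zero, sub_zero]
    positivity
  refine exists_symbol_bound hsmooth (F := F) ?_ ?_ α
  · intro x hx
    obtain ⟨hρ, he, hvec, ha, ha0, hD0⟩ := hae x hx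
    have hρ2 : ContDiffAt ℝ ∞ (fun q : ℝ × Eucl 2 => ρ q.2) (0, x) :=
      ContDiffAt.comp (g := ρ) (0, x) hρ contDiffAt_snd
    have hD : ContDiffAt ℝ ∞ (fun q => √(D q)) (0, x) :=
      ((ha.pow 2).sub (contDiffAt_const.mul he)).sqrt hD0.ne'
    have hlog : ContDiffAt ℝ ∞ (fun q => Real.log ((a q + √(D q)) / 2)) (0, x) :=
      ((ha.add hD).div_const 2).log (by positivity)
    exact A.contDiff.contDiffAt.comp _
      (((hρ2.add (contDiffAt_fst.mul hlog)).div hD (Real.sqrt_pos.2 hD0).ne').smul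
        (hvec.sub (ha.smul contDiffAt_const)))
  · intro x hx
    obtain ⟨hρ, he, hvec, ha, ha0, hD0⟩ := hae x hx
    have hD : ContinuousAt D (0, x) :=
      (ha.continuousAt.pow 2).sub (continuousAt_const.mul he.continuousAt)
    have hne : ∀ᶠ q : ℝ × Eucl 2 in 𝓝 (0, x), B q.2 ≠ 0 :=
      (B.continuous.comp continuous_snd).continuousAt.eventually_ne (hB x hx)
    filter_upwards [hne, ha.continuousAt.eventually_const_lt ha0, hD.eventually_const_lt hD0]
      with ⟨ε, y⟩ hBy hay hDy hε
    simp only at hBy hε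
    have hε' : 0 < ε⁻¹ := inv_pos.2 hε
    have hv : ε⁻¹ • B y ≠ 0 := smul_ne_zero hε'.ne' hBy
    have hey : e (ε, y) = Real.exp (-2 * rNorm u' (ε⁻¹ • B y)) := by
      have hpos := rNorm_pos u' hBy
      have h1 : ¬ ε / (2 * ρ y) ≤ 0 := not_le.2 (by positivity)
      simp only [e, expNegInvGlue, h1, if_false, rNorm_smul u' _ hε'.le]
      congr 1
      simp only [ρ]
      field_simp
    have hayy : a (ε, y) = rayPairing u u' (e (ε, y)) (ε⁻¹ • B y) := by
      rw [rayPairing_smul _ _ _ _ hε']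
    have key := logCoord_expCoord_eq u u' hv hey hayy (D := D (ε, y)) rfl hay hDy
    simp only [F]
    rw [map_smul B, key, rayVec_smul _ _ _ hε', rNorm_smul u' _ hε'.le, map_smul A, map_smul A,
      smul_smul]
    congr 2
    simp only [ρ]
    field_simp

end HyperbolicPlane

/-! ### The Levi-Civita connection in the graph chart -/

namespace HyperbolicPlane

theorem contMDiff_projHomeo : ContMDiff (𝓡 2) (𝓡 2) ∞ (fun p : HyperbolicPlane => projHomeo p) :=
  fun q => contMDiffAt_extChartAt (I := 𝓡 2) (x := q)

theorem contMDiff_projHomeo_symm : ContMDiff (𝓡 2) (𝓡 2) ∞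
    (fun u : Eucl 2 => projHomeo.symm u) := by
  have h := contMDiffOn_extChartAt_symm (I := 𝓡 2) (n := ∞) (projHomeo.symm 0)
  intro u
  exact (h u (by simp [extChartAt])).contMDiffAt (by simp [extChartAt])

/-- In the tangent spaces of Mathlib, the differential of a global chart is the identity. -/
theorem mfderiv_projHomeo (p : HyperbolicPlane) (v : Eucl 2) :
    (mfderiv (𝓡 2) (𝓡 2) (fun p : HyperbolicPlane => projHomeo p) p : Eucl 2 →L[ℝ] Eucl 2) v
      = v := by
  have h : HasMFDerivAt (𝓡 2) (𝓡 2) (fun p : HyperbolicPlane => projHomeo p) p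
      (ContinuousLinearMap.id ℝ (Eucl 2)) := by
    refine ⟨projHomeo.continuous.continuousAt, ?_⟩
    have : writtenInExtChartAt (𝓡 2) (𝓡 2) p (fun p : HyperbolicPlane => projHomeo p) = id := by
      funext u
      simp only [writtenInExtChartAt, extChartAt, chartAt_self_eq, mfld_simps]
      exact projHomeo.apply_symm_apply u
    rw [this]
    exact (hasFDerivAt_id _).hasFDerivWithinAt
  exact congrArg (fun L : Eucl 2 →L[ℝ] Eucl 2 => L v) h.mfderiv

theorem mfderiv_projHomeo_symm (u : Eucl 2) (v : Eucl 2) :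
    (mfderiv (𝓡 2) (𝓡 2) (fun u : Eucl 2 => projHomeo.symm u) u : Eucl 2 →L[ℝ] Eucl 2) v
      = v := by
  have h : HasMFDerivAt (𝓡 2) (𝓡 2) (fun u : Eucl 2 => projHomeo.symm u) u
      (ContinuousLinearMap.id ℝ (Eucl 2)) := by
    refine ⟨projHomeo.symm.continuous.continuousAt, ?_⟩
    have : writtenInExtChartAt (𝓡 2) (𝓡 2) u (fun u : Eucl 2 => projHomeo.symm u) = id := by
      funext u
      simp only [writtenInExtChartAt, extChartAt, chartAt_self_eq, mfld_simps]
      exact projHomeo.apply_symm_apply u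
    rw [this]
    exact (hasFDerivAt_id _).hasFDerivWithinAt
  exact congrArg (fun L : Eucl 2 →L[ℝ] Eucl 2 => L v) h.mfderiv

theorem coordField_eq (x₀ : HyperbolicPlane) (u : Eucl 2) (i : Fin 2) :
    coordField x₀ u i = (EuclideanSpace.single i (1 : ℝ) : Eucl 2) :=
  mfderiv_projHomeo_symm u _

/-- The polarization of `minkowski_fderiv_graphMap`. -/
theorem minkowski_fderiv_graphMap_polar (u v w : Eucl 2) :
    minkowski (fderiv ℝ graphMap u v) (fderiv ℝ graphMap u w) =
      v 0 * w 0 + v 1 * w 1 - (u 0 * v 0 + u 1 * v 1) * (u 0 * w 0 + u 1 * w 1) /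
        (1 + u 0 ^ 2 + u 1 ^ 2) := by
  have h := minkowski_fderiv_graphMap u (v + w)
  have hv := minkowski_fderiv_graphMap u v
  have hw := minkowski_fderiv_graphMap u w
  have hs : minkowski (fderiv ℝ graphMap u w) (fderiv ℝ graphMap u v) =
      minkowski (fderiv ℝ graphMap u v) (fderiv ℝ graphMap u w) := by
    simp only [minkowski_apply]; ring
  simp only [map_add, add_apply, PiLp.add_apply] at h
  have hq := (graphMap_pos u).ne'
  field_simp at h hv hw ⊢
  linear_combination (h - hv - hw) / 2 - (1 + u 0 ^ 2 + u 1 ^ 2) / 2 * hs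

/-- The coefficient `δᵢⱼ - uᵢ uⱼ / (1 + |u|²)` of the metric in the graph chart. -/
noncomputable def metricCoeff (u : Eucl 2) (i j : Fin 2) : ℝ :=
  (if i = j then 1 else 0) - u i * u j / (1 + u 0 ^ 2 + u 1 ^ 2)

theorem metricMatrix_apply (x₀ : HyperbolicPlane) (u : Eucl 2) (i j : Fin 2) :
    metricMatrix metric x₀ u i j = metricCoeff u i j := by
  have h : metricMatrix metric x₀ u i j = inducedForm (projHomeo.symm u)
      (EuclideanSpace.single i (1 : ℝ) : Eucl 2) (EuclideanSpace.single j (1 : ℝ) : Eucl 2) :=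
    congrArg₂ (fun a b : Eucl 2 => inducedForm (projHomeo.symm u) a b)
      (coordField_eq x₀ u i) (coordField_eq x₀ u j)
  rw [h]
  refine (inducedForm_apply _ _ _).trans ?_
  rw [projHomeo.apply_symm_apply, minkowski_fderiv_graphMap_polar, metricCoeff]
  fin_cases i <;> fin_cases j <;> simp

theorem metricMatrix_inv_apply (x₀ : HyperbolicPlane) (u : Eucl 2) (i j : Fin 2) :
    (metricMatrix metric x₀ u)⁻¹ i j = (if i = j then 1 else 0) + u i * u j := by
  have h : metricMatrix metric x₀ u *
      Matrix.of (fun i j => (if i = j then (1 : ℝ) else 0) + u i * u j) = 1 := by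
    have hq := (graphMap_pos u).ne'
    ext i j
    rw [Matrix.mul_apply, Fin.sum_univ_two, metricMatrix_apply, metricMatrix_apply, metricCoeff,
      metricCoeff]
    fin_cases i <;> fin_cases j <;> simp <;> field_simp <;> ring
  rw [Matrix.inv_eq_right_inv h, Matrix.of_apply]

theorem pderiv_metricCoeff (u : Eucl 2) (i j l : Fin 2) :
    pderiv l (fun w => metricCoeff w i j) u =
      2 * u l * u i * u j / (1 + u 0 ^ 2 + u 1 ^ 2) ^ 2
        - ((if l = i then 1 else 0) * u j + u i * (if l = j then 1 else 0)) /
          (1 + u 0 ^ 2 + u 1 ^ 2) := by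
  have hp (i : Fin 2) : HasFDerivAt (fun w : Eucl 2 => w i) (EuclideanSpace.proj (𝕜 := ℝ) i) u :=
    (EuclideanSpace.proj (𝕜 := ℝ) i).hasFDerivAt
  have hq := (graphMap_pos u).ne'
  have hinv := (hasDerivAt_inv hq).comp_hasFDerivAt u
    (((hp 0).pow 2).const_add 1 |>.add ((hp 1).pow 2))
  have h := (((hp i).mul (hp j)).mul hinv).const_sub (if i = j then (1 : ℝ) else 0)
  have h2 : fderiv ℝ (fun w => metricCoeff w i j) u = _ := h.fderiv
  rw [pderiv, h2]
  fin_cases i <;> fin_cases j <;> fin_cases l <;> simp <;> field_simp <;> ring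

/-- The Christoffel symbols are `Γᵏᵢⱼ = - gᵢⱼ uₖ`, since the normal vector of the hyperboloid at `x`
is `x` itself. -/
theorem christoffel_eq (x₀ : HyperbolicPlane) (u : Eucl 2) (k i j : Fin 2) :
    christoffel metric x₀ u k i j = - metricCoeff u i j * u k := by
  have hq := (graphMap_pos u).ne'
  simp only [christoffel, metricMatrix_apply, metricMatrix_inv_apply, pderiv_metricCoeff,
    Fin.sum_univ_two]
  simp only [metricCoeff]
  fin_cases k <;> fin_cases i <;> fin_cases j <;> simp <;> field_simp <;> ring

theorem sum_metricCoeff (u v : Eucl 2) :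
    ∑ i, ∑ j, metricCoeff u i j * v i * v j = normSq u v := by
  have hq := (graphMap_pos u).ne'
  rw [normSq, dHeight, div_pow, height_sq]
  simp only [Fin.sum_univ_two, metricCoeff]
  simp
  field_simp
  ring

end HyperbolicPlane

/-! ### Geodesics -/

namespace HyperbolicPlane

theorem hasDerivAt_coshSqrt_mul {s : ℝ} (hs : 0 ≤ s) (t : ℝ) :
    HasDerivAt (fun t => coshSqrt (t ^ 2 * s)) (s * (t * sinhcSqrt (t ^ 2 * s))) t := by
  have hc : ∀ t : ℝ, coshSqrt (t ^ 2 * s) = Real.cosh (t * √s) := fun t => by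
    rw [← coshSqrt_sq, mul_pow, Real.sq_sqrt hs]
  have hsq := mul_sinhcSqrt_sq (t * √s)
  rw [mul_pow, Real.sq_sqrt hs] at hsq
  simp only [hc]
  convert ((hasDerivAt_id' t).mul_const (√s)).cosh using 1
  rw [← hsq]
  linear_combination (-(t * sinhcSqrt (t ^ 2 * s))) * Real.sq_sqrt hs

theorem hasDerivAt_mul_sinhcSqrt_mul {s : ℝ} (hs : 0 ≤ s) (t : ℝ) :
    HasDerivAt (fun t => t * sinhcSqrt (t ^ 2 * s)) (coshSqrt (t ^ 2 * s)) t := by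
  rcases hs.eq_or_lt with rfl | hs'
  · simpa [sinhcSqrt_zero, coshSqrt_zero] using hasDerivAt_id' t
  · have h0 : √s ≠ 0 := (Real.sqrt_pos.2 hs').ne'
    have hc : ∀ t : ℝ, t * sinhcSqrt (t ^ 2 * s) = Real.sinh (t * √s) / √s := fun t => by
      rw [← mul_sinhcSqrt_sq, mul_pow, Real.sq_sqrt hs]
      field_simp
    have hsq := coshSqrt_sq (t * √s)
    rw [mul_pow, Real.sq_sqrt hs] at hsq
    simp only [hc]
    refine ((((hasDerivAt_id' t).mul_const (√s)).sinh).div_const (√s)).congr_deriv ?_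
    rw [← hsq]
    field_simp

theorem coshSqrt_mul_sq_eq {s : ℝ} (hs : 0 ≤ s) (t : ℝ) :
    coshSqrt (t ^ 2 * s) ^ 2 = 1 + s * (t * sinhcSqrt (t ^ 2 * s)) ^ 2 := by
  rw [coshSqrt_sq_eq (by positivity)]
  ring

/-- The solution of the linear equation `ẍ = s x`: variation of constants shows that both
constants of the general solution are first integrals. -/
theorem eq_of_second_deriv_eq_mul {s : ℝ} (hs : 0 ≤ s) {x x' : ℝ → ℝ}
    (hx : ∀ t, HasDerivAt x (x' t) t) (hx' : ∀ t, HasDerivAt x' (s * x t) t) (t : ℝ) :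
    x t = x 0 * coshSqrt (t ^ 2 * s) + x' 0 * (t * sinhcSqrt (t ^ 2 * s)) := by
  set C : ℝ → ℝ := fun t => coshSqrt (t ^ 2 * s) with hC
  set S : ℝ → ℝ := fun t => t * sinhcSqrt (t ^ 2 * s) with hS
  have dC : ∀ t, HasDerivAt C (s * S t) t := hasDerivAt_coshSqrt_mul hs
  have dS : ∀ t, HasDerivAt S (C t) t := hasDerivAt_mul_sinhcSqrt_mul hs
  have hP : ∀ t, HasDerivAt (fun t => x t * C t - x' t * S t) 0 t := fun t => by
    refine (((hx t).mul (dC t)).sub ((hx' t).mul (dS t))).congr_deriv ?_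
    ring
  have hQ : ∀ t, HasDerivAt (fun t => x' t * C t - s * x t * S t) 0 t := fun t => by
    refine (((hx' t).mul (dC t)).sub (((hx t).const_mul s).mul (dS t))).congr_deriv ?_
    ring
  have hP0 := is_const_of_deriv_eq_zero (fun t => (hP t).differentiableAt)
    (fun t => (hP t).deriv) t 0
  have hQ0 := is_const_of_deriv_eq_zero (fun t => (hQ t).differentiableAt)
    (fun t => (hQ t).deriv) t 0
  have hCS : C t ^ 2 = 1 + s * S t ^ 2 := coshSqrt_mul_sq_eq hs t
  have hC0 : C 0 = 1 := by simp [hC, coshSqrt_zero]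
  have hS0 : S 0 = 0 := by simp [hS]
  simp only [hC0, hS0, mul_one, mul_zero, sub_zero] at hP0 hQ0
  change x t = x 0 * C t + x' 0 * S t
  rw [← hP0, ← hQ0]
  linear_combination (-x t) * hCS

/-- The speed of a solution of the geodesic equation is constant. -/
theorem speed_eq_of_geodesic_equation {x y x' y' : ℝ → ℝ} {N : ℝ → ℝ}
    (hN : ∀ t, N t = x' t ^ 2 + y' t ^ 2 -
      (x t * x' t + y t * y' t) ^ 2 / (1 + x t ^ 2 + y t ^ 2))
    (hx : ∀ t, HasDerivAt x (x' t) t) (hy : ∀ t, HasDerivAt y (y' t) t)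
    (hx' : ∀ t, HasDerivAt x' (N t * x t) t) (hy' : ∀ t, HasDerivAt y' (N t * y t) t) (t : ℝ) :
    N t = N 0 := by
  have hd : ∀ t, HasDerivAt N 0 t := by
    intro t
    have hq : 1 + x t ^ 2 + y t ^ 2 ≠ 0 := by positivity
    have hB := ((hx t).mul (hx' t)).add ((hy t).mul (hy' t))
    have hQ := (((hx t).pow 2).const_add 1).add ((hy t).pow 2)
    have hd := (((hx' t).pow 2).add ((hy' t).pow 2)).sub ((hB.pow 2).div hQ hq)
    have hfun : N = fun t => x' t ^ 2 + y' t ^ 2 -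
      (x t * x' t + y t * y' t) ^ 2 / (1 + x t ^ 2 + y t ^ 2) := funext hN
    rw [hfun]
    refine HasDerivAt.congr_deriv hd ?_
    have hNt := hN t
    simp only [Pi.add_apply, Pi.mul_apply, Pi.pow_apply]
    rw [hNt]
    field_simp
    ring
  exact is_const_of_deriv_eq_zero (fun t => (hd t).differentiableAt) (fun t => (hd t).deriv) t 0

theorem hasDerivAt_apply {c : ℝ → Eucl 2} {c' : Eucl 2} {t : ℝ} (h : HasDerivAt c c' t)
    (i : Fin 2) : HasDerivAt (fun s => c s i) (c' i) t :=
  (EuclideanSpace.proj (𝕜 := ℝ) i).hasFDerivAt.comp_hasDerivAt t h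

/-- The geodesic equation in the graph chart: the acceleration in `ℝ³` is normal. -/
def GeodesicEquation (c : ℝ → Eucl 2) : Prop :=
  ∀ t, deriv (deriv c) t = normSq (c t) (deriv c t) • c t

theorem expCoord_smul (u v : Eucl 2) (t : ℝ) : expCoord u (t • v) =
    coshSqrt (t ^ 2 * normSq u v) • u + (t * sinhcSqrt (t ^ 2 * normSq u v)) • v := by
  rw [expCoord, normSq_smul, smul_smul, mul_comm t]

theorem eq_expCoord_of_geodesicEquation {c : ℝ → Eucl 2} (hc : ContDiff ℝ ∞ c)
    (h : GeodesicEquation c) (t : ℝ) : c t = expCoord (c 0) (t • deriv c 0) := by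
  have hc' : ContDiff ℝ ∞ (deriv c) := ((contDiff_infty_iff_deriv (𝕜 := ℝ)).1 hc).2
  have d1 : ∀ t, HasDerivAt c (deriv c t) t := fun t =>
    (hc.differentiable (by simp) t).hasDerivAt
  have d2 : ∀ t, HasDerivAt (deriv c) (normSq (c t) (deriv c t) • c t) t := fun t => by
    rw [← h t]
    exact (hc'.differentiable (by simp) t).hasDerivAt
  have hconst : ∀ t, normSq (c t) (deriv c t) = normSq (c 0) (deriv c 0) := by
    refine speed_eq_of_geodesic_equation (x := fun t => c t 0) (y := fun t => c t 1)
      (x' := fun t => deriv c t 0) (y' := fun t => deriv c t 1) (fun t => ?_)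
      (fun t => hasDerivAt_apply (d1 t) 0) (fun t => hasDerivAt_apply (d1 t) 1)
      (fun t => hasDerivAt_apply (d2 t) 0) (fun t => hasDerivAt_apply (d2 t) 1)
    rw [normSq, dHeight, div_pow, height_sq]
  rw [expCoord_smul]
  ext i
  have := eq_of_second_deriv_eq_mul (normSq_nonneg (c 0) (deriv c 0))
    (fun t => hasDerivAt_apply (d1 t) i) (x' := fun t => deriv c t i)
    (fun t => by rw [← hconst t]; exact hasDerivAt_apply (d2 t) i) t
  simp only [PiLp.add_apply, PiLp.smul_apply, smul_eq_mul]
  rw [this]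
  ring

theorem contDiff_expCoord_smul (u v : Eucl 2) : ContDiff ℝ ∞ (fun t : ℝ => expCoord u (t • v)) :=
  (contDiff_expCoord_right u).comp (by fun_prop)

theorem hasDerivAt_expCoord_smul (u v : Eucl 2) (t : ℝ) :
    HasDerivAt (fun t : ℝ => expCoord u (t • v))
      ((normSq u v * (t * sinhcSqrt (t ^ 2 * normSq u v))) • u +
        coshSqrt (t ^ 2 * normSq u v) • v) t := by
  simp only [expCoord_smul]
  exact ((hasDerivAt_coshSqrt_mul (normSq_nonneg u v) t).smul_const u).add
    ((hasDerivAt_mul_sinhcSqrt_mul (normSq_nonneg u v) t).smul_const v)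

theorem deriv_expCoord_smul_zero (u v : Eucl 2) :
    deriv (fun t : ℝ => expCoord u (t • v)) 0 = v := by
  rw [(hasDerivAt_expCoord_smul u v 0).deriv]
  simp [coshSqrt_zero]

theorem expCoord_zero (u : Eucl 2) : expCoord u 0 = u := by
  have : normSq u 0 = 0 := by simp [normSq, dHeight]
  rw [expCoord, this]
  simp [coshSqrt_zero]

/-- The velocity of the curve `cosh t√s • X + (sinh t√s / √s) • V` has the same norm as `V`. -/
theorem normSq_combination (u v : Eucl 2) {cc ss : ℝ} (hcc : 0 ≤ cc)
    (h : cc ^ 2 = 1 + normSq u v * ss ^ 2) :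
    normSq (cc • u + ss • v) ((normSq u v * ss) • u + cc • v) = normSq u v := by
  have h1 := height_sq u
  have h2 := height_mul_dHeight u v
  have h3 := height_combination u v hcc h
  have hn : normSq u v = v 0 ^ 2 + v 1 ^ 2 - dHeight u v ^ 2 := rfl
  have h0 := height_pos (cc • u + ss • v)
  have hd : dHeight (cc • u + ss • v) ((normSq u v * ss) • u + cc • v) =
      normSq u v * ss * height u + cc * dHeight u v := by
    rw [dHeight, div_eq_iff h0.ne', h3]
    simp only [PiLp.add_apply, PiLp.smul_apply, smul_eq_mul]
    linear_combination (-(cc * ss * normSq u v)) * h1 -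
      (cc ^ 2 + normSq u v * ss ^ 2) * h2 - cc * ss * hn
  conv_lhs => rw [normSq, hd]
  simp only [PiLp.add_apply, PiLp.smul_apply, smul_eq_mul]
  linear_combination (-(normSq u v * ss) ^ 2) * h1 - 2 * (normSq u v * ss * cc) * h2 -
    cc ^ 2 * hn + normSq u v * h

theorem geodesicEquation_expCoord_smul (u v : Eucl 2) :
    GeodesicEquation (fun t : ℝ => expCoord u (t • v)) := by
  intro t
  have hs := normSq_nonneg u v
  have h1 : deriv (fun t : ℝ => expCoord u (t • v)) = fun t =>
      (normSq u v * (t * sinhcSqrt (t ^ 2 * normSq u v))) • u +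
        coshSqrt (t ^ 2 * normSq u v) • v :=
    funext fun t => (hasDerivAt_expCoord_smul u v t).deriv
  have h2 := ((((hasDerivAt_mul_sinhcSqrt_mul hs t).const_mul (normSq u v)).smul_const u).add
    ((hasDerivAt_coshSqrt_mul hs t).smul_const v))
  rw [h1]
  simp only [expCoord_smul]
  rw [normSq_combination u v (zero_le_one.trans (one_le_coshSqrt (by positivity)))
    (coshSqrt_mul_sq_eq hs t)]
  refine h2.deriv.trans ?_
  rw [smul_add, smul_smul, smul_smul]

theorem contMDiff_curve_iff (γ : ℝ → HyperbolicPlane) :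
    ContMDiff 𝓘(ℝ, ℝ) (𝓡 2) ∞ γ ↔ ContDiff ℝ ∞ (fun t => projHomeo (γ t)) := by
  refine ⟨fun h => (contMDiff_projHomeo.comp h).contDiff, fun h => ?_⟩
  have h2 := contMDiff_projHomeo_symm.comp h.contMDiff
  refine h2.congr fun t => ?_
  exact (projHomeo.symm_apply_apply (γ t)).symm

theorem isGeodesic_iff (γ : ℝ → HyperbolicPlane) : IsGeodesic metric γ ↔
    ContDiff ℝ ∞ (fun t => projHomeo (γ t)) ∧ GeodesicEquation (fun t => projHomeo (γ t)) := by
  rw [IsGeodesic, contMDiff_curve_iff]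
  refine and_congr_right fun hc => ?_
  set c : ℝ → Eucl 2 := fun t => projHomeo (γ t) with hcdef
  have hc' : ContDiff ℝ ∞ (deriv c) := ((contDiff_infty_iff_deriv (𝕜 := ℝ)).1 hc).2
  have d1 : ∀ t i, deriv (fun s => c s i) t = deriv c t i := fun t i =>
    (hasDerivAt_apply (hc.differentiable (by simp) t).hasDerivAt i).deriv
  have d2 : ∀ t i, deriv (deriv (fun s => c s i)) t = deriv (deriv c) t i := fun t i => by
    rw [show deriv (fun s => c s i) = fun t => deriv c t i from funext fun t => d1 t i]
    exact (hasDerivAt_apply (hc'.differentiable (by simp) t).hasDerivAt i).deriv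
  refine forall_congr' fun t => ?_
  have key : ∀ k : Fin 2, (deriv (deriv (fun s => c s k)) t +
      ∑ i, ∑ j, christoffel metric (γ t) (c t) k i j * deriv (fun s => c s i) t *
        deriv (fun s => c s j) t = 0) ↔
      deriv (deriv c) t k = (normSq (c t) (deriv c t) • c t) k := by
    intro k
    have hsum : ∑ i, ∑ j, christoffel metric (γ t) (c t) k i j * deriv (fun s => c s i) t *
        deriv (fun s => c s j) t = - (normSq (c t) (deriv c t) * c t k) := by
      rw [← sum_metricCoeff, Finset.sum_mul, ← Finset.sum_neg_distrib]
      refine Finset.sum_congr rfl fun i _ => ?_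
      rw [Finset.sum_mul, ← Finset.sum_neg_distrib]
      refine Finset.sum_congr rfl fun j _ => ?_
      rw [christoffel_eq, d1, d1]
      ring
    rw [hsum, d2, PiLp.smul_apply, smul_eq_mul, add_neg_eq_zero]
  refine (forall_congr' key).trans ⟨fun h => ?_, fun h k => ?_⟩
  · ext k; exact h k
  · rw [h]

/-- The tangent vector at `p` with coordinates `w`. -/
def mkTangent (p : HyperbolicPlane) (w : Eucl 2) : TangentBundle (𝓡 2) HyperbolicPlane := ⟨p, w⟩

theorem mkTangent_inj {p q : HyperbolicPlane} {w z : Eucl 2} :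
    mkTangent p w = mkTangent q z ↔ p = q ∧ w = z := by
  constructor
  · intro h
    have h1 : p = q := congrArg (fun v : TangentBundle (𝓡 2) HyperbolicPlane => v.proj) h
    subst h1
    exact ⟨rfl, eq_of_heq (TotalSpace.mk.inj h).2⟩
  · rintro ⟨rfl, rfl⟩
    rfl

theorem velocity_eq {γ : ℝ → HyperbolicPlane} (hγ : ContMDiff 𝓘(ℝ, ℝ) (𝓡 2) ∞ γ) (t : ℝ) :
    velocity γ t = mkTangent (γ t) (deriv (fun t => projHomeo (γ t)) t) := by
  have h1 : MDifferentiableAt 𝓘(ℝ, ℝ) (𝓡 2) γ t := hγ.mdifferentiable (by simp) t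
  have h2 : MDifferentiableAt (𝓡 2) (𝓡 2) (fun p : HyperbolicPlane => projHomeo p) (γ t) :=
    contMDiff_projHomeo.mdifferentiable (by simp) _
  have h3 := mfderiv_comp_apply t h2 h1 (1 : ℝ)
  have h4 : (mfderiv 𝓘(ℝ, ℝ) (𝓡 2) γ t (1 : ℝ) : Eucl 2) =
      deriv (fun t => projHomeo (γ t)) t := by
    refine (mfderiv_projHomeo (γ t) _).symm.trans (h3.symm.trans ?_)
    have h5 : mfderiv 𝓘(ℝ, ℝ) (𝓡 2) ((fun p : HyperbolicPlane => projHomeo p) ∘ γ) t =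
        fderiv ℝ (fun t => projHomeo (γ t)) t := mfderiv_eq_fderiv
    exact (congrArg (fun L : ℝ →L[ℝ] Eucl 2 => L 1) h5).trans fderiv_apply_one_eq_deriv
  exact congrArg (fun w : Eucl 2 => mkTangent (γ t) w) h4

/-- The geodesic with initial velocity `mkTangent p w`: the curve `t ↦ exp_p (t w)`. -/
noncomputable def geodesic (p : HyperbolicPlane) (w : Eucl 2) (t : ℝ) : HyperbolicPlane :=
  projHomeo.symm (expCoord (projHomeo p) (t • w))

theorem projHomeo_geodesic (p : HyperbolicPlane) (w : Eucl 2) (t : ℝ) :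
    projHomeo (geodesic p w t) = expCoord (projHomeo p) (t • w) :=
  projHomeo.apply_symm_apply _

theorem isGeodesic_geodesic (p : HyperbolicPlane) (w : Eucl 2) :
    IsGeodesic metric (geodesic p w) := by
  rw [isGeodesic_iff]
  simp only [projHomeo_geodesic]
  exact ⟨contDiff_expCoord_smul _ _, geodesicEquation_expCoord_smul _ _⟩

theorem velocity_geodesic (p : HyperbolicPlane) (w : Eucl 2) :
    velocity (geodesic p w) 0 = mkTangent p w := by
  rw [velocity_eq (isGeodesic_geodesic p w).1, mkTangent_inj]
  simp only [projHomeo_geodesic, deriv_expCoord_smul_zero, and_true]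
  rw [geodesic, zero_smul, expCoord_zero, projHomeo.symm_apply_apply]

theorem eq_geodesic {p : HyperbolicPlane} {w : Eucl 2} {γ : ℝ → HyperbolicPlane}
    (hγ : IsGeodesic metric γ) (h0 : velocity γ 0 = mkTangent p w) : γ = geodesic p w := by
  rw [velocity_eq hγ.1, mkTangent_inj] at h0
  obtain ⟨hp, hw⟩ := h0
  obtain ⟨h1, h2⟩ := (isGeodesic_iff γ).1 hγ
  funext t
  apply projHomeo.injective
  rw [projHomeo_geodesic, ← hp, ← hw]
  exact eq_expCoord_of_geodesicEquation h1 h2 t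

theorem existsUnique_geodesic (v : TangentBundle (𝓡 2) HyperbolicPlane) :
    ∃! γ : ℝ → HyperbolicPlane, IsGeodesic metric γ ∧ velocity γ 0 = v :=
  ⟨geodesic v.proj v.snd, ⟨isGeodesic_geodesic _ _, velocity_geodesic _ _⟩,
    fun _ h => eq_geodesic h.1 h.2⟩

theorem riemannianExp_mkTangent (p : HyperbolicPlane) (w : Eucl 2) :
    riemannianExp metric (mkTangent p w) = projHomeo.symm (expCoord (projHomeo p) w) := by
  have h : ∃ γ : ℝ → HyperbolicPlane, IsGeodesic metric γ ∧ velocity γ 0 = mkTangent p w :=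
    (existsUnique_geodesic _).exists
  rw [riemannianExp, dif_pos h, eq_geodesic h.choose_spec.1 h.choose_spec.2, geodesic, one_smul]

end HyperbolicPlane

/-! ### The hyperbolic plane as an exponential manifold -/

namespace HyperbolicPlane

/-- The fibre coordinate of `Tℍ` is smooth, as the fibre part of the differential of the chart. -/
theorem contMDiff_tangentBundle_snd : ContMDiff (𝓡 2).tangent (𝓡 2) ∞
    (fun v : TangentBundle (𝓡 2) HyperbolicPlane => (v.snd : Eucl 2)) := by
  have h1 : ContMDiff (𝓡 2).tangent (𝓡 2).tangent ∞
      (tangentMap (𝓡 2) (𝓡 2) (fun p : HyperbolicPlane => projHomeo p)) :=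
    contMDiff_projHomeo.contMDiff_tangentMap (by simp)
  have h2 := (contMDiff_snd_tangentBundle_modelSpace (n := ∞) (Eucl 2) (𝓡 2)).comp h1
  exact h2.congr fun v => (mfderiv_projHomeo v.proj v.snd).symm

theorem contMDiff_riemannianExp :
    ContMDiff (𝓡 2).tangent (𝓡 2) ∞ (riemannianExp metric) := by
  have h1 : ContMDiff (𝓡 2).tangent (𝓡 2) ∞
      (fun v : TangentBundle (𝓡 2) HyperbolicPlane => projHomeo v.proj) :=
    contMDiff_projHomeo.comp (contMDiff_proj (TangentSpace (𝓡 2)))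
  have h2 : ContMDiff (𝓡 2).tangent 𝓘(ℝ, Eucl 2 × Eucl 2) ∞
      (fun v : TangentBundle (𝓡 2) HyperbolicPlane => (projHomeo v.proj, (v.snd : Eucl 2))) :=
    h1.prodMk_space contMDiff_tangentBundle_snd
  have h3 := contMDiff_projHomeo_symm.comp (contDiff_expCoord.contMDiff.comp h2)
  refine h3.congr fun v => ?_
  exact riemannianExp_mkTangent v.proj v.snd

/-- The diffeomorphism `exp_p : T_p ℍ → ℍ`. -/
noncomputable def expDiffeo (p : HyperbolicPlane) : Eucl 2 ≃ₘ^∞⟮𝓡 2, 𝓡 2⟯ HyperbolicPlane where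
  toFun w := projHomeo.symm (expCoord (projHomeo p) w)
  invFun q := logCoord (projHomeo p) (projHomeo q)
  left_inv w := by simp only [projHomeo.apply_symm_apply, logCoord_expCoord]
  right_inv q := by simp only [expCoord_logCoord, projHomeo.symm_apply_apply]
  contMDiff_toFun := contMDiff_projHomeo_symm.comp (contDiff_expCoord_right _).contMDiff
  contMDiff_invFun := (contDiff_logCoord _).contMDiff.comp contMDiff_projHomeo

theorem riemannianExp_eq_expDiffeo (p : HyperbolicPlane) :
    (fun w : Eucl 2 => riemannianExp metric (mkTangent p w)) = expDiffeo p :=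
  funext fun w => riemannianExp_mkTangent p w

theorem fderiv_expCoord_zero (u v : Eucl 2) : fderiv ℝ (expCoord u) 0 v = v := by
  have h1 : HasFDerivAt (expCoord u) (fderiv ℝ (expCoord u) 0) ((0 : ℝ) • v) := by
    rw [zero_smul]
    exact ((contDiff_expCoord_right u (n := 1)).differentiable (by simp) 0).hasFDerivAt
  have h2 : HasDerivAt (fun t : ℝ => t • v) v 0 := by
    simpa using (hasDerivAt_id' (0 : ℝ)).smul_const v
  rw [← (h1.comp_hasDerivAt (0 : ℝ) h2).deriv]
  exact deriv_expCoord_smul_zero u v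

theorem tangentMap_exp_zero (p : HyperbolicPlane) (v : Eucl 2) :
    tangentMap (𝓡 2) (𝓡 2) (fun w : Eucl 2 => riemannianExp metric (mkTangent p w)) ⟨0, v⟩ =
      mkTangent p v := by
  rw [riemannianExp_eq_expDiffeo]
  have h0 : expDiffeo p 0 = p := by
    change projHomeo.symm (expCoord (projHomeo p) 0) = p
    rw [expCoord_zero, projHomeo.symm_apply_apply]
  have h1 : MDifferentiableAt (𝓡 2) (𝓡 2) (expDiffeo p) 0 :=
    (expDiffeo p).contMDiff_toFun.mdifferentiable (by simp) 0
  have h2 : MDifferentiableAt (𝓡 2) (𝓡 2) (fun p : HyperbolicPlane => projHomeo p)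
      (expDiffeo p 0) := contMDiff_projHomeo.mdifferentiable (by simp) _
  have h3 := mfderiv_comp_apply (0 : Eucl 2) h2 h1 v
  have h4 : (mfderiv (𝓡 2) (𝓡 2) (expDiffeo p) 0 v : Eucl 2) = v := by
    refine (mfderiv_projHomeo _ _).symm.trans (h3.symm.trans ?_)
    have h5 : (fun p : HyperbolicPlane => projHomeo p) ∘ expDiffeo p = expCoord (projHomeo p) :=
      funext fun w => projHomeo.apply_symm_apply _
    have h6 : mfderiv (𝓡 2) (𝓡 2) ((fun p : HyperbolicPlane => projHomeo p) ∘ expDiffeo p) 0 =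
        fderiv ℝ (expCoord (projHomeo p)) 0 := by
      rw [h5]
      exact mfderiv_eq_fderiv
    exact (congrArg (fun L : Eucl 2 →L[ℝ] Eucl 2 => L v) h6).trans (fderiv_expCoord_zero _ v)
  exact mkTangent_inj.2 ⟨h0, h4⟩

theorem isExponentialManifold : IsExponentialManifold (riemannianExp metric) where
  smooth := contMDiff_riemannianExp
  diffeo p := ⟨expDiffeo p, fun v => (riemannianExp_mkTangent p v).symm⟩
  exp_zero p := by
    refine (riemannianExp_mkTangent p 0).trans ?_
    rw [expCoord_zero, projHomeo.symm_apply_apply]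
  deriv_zero p v := tangentMap_exp_zero p v

/-- The coordinate isomorphism `ℝ² → ℝ²` of a basis, as a continuous linear equivalence. -/
noncomputable def basisCoord (b : Module.Basis (Fin 2) ℝ (Eucl 2)) : Eucl 2 ≃L[ℝ] Eucl 2 :=
  (b.equivFun.trans (WithLp.linearEquiv 2 ℝ (Fin 2 → ℝ)).symm).toContinuousLinearEquiv

theorem normalChange_eq (p p' : HyperbolicPlane)
    (b : Module.Basis (Fin 2) ℝ (TangentSpace (𝓡 2) p))
    (b' : Module.Basis (Fin 2) ℝ (TangentSpace (𝓡 2) p')) :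
    normalChange (riemannianExp metric) p p' b b' = fun x =>
      basisCoord b (logCoord (projHomeo p) (expCoord (projHomeo p') ((basisCoord b').symm x))) := by
  funext x
  have hinv : ∀ q, Function.invFun (fun v : Eucl 2 => riemannianExp metric (mkTangent p v)) q =
      logCoord (projHomeo p) (projHomeo q) := fun q => by
    rw [riemannianExp_eq_expDiffeo]
    exact (expDiffeo p).injective ((Function.invFun_eq ((expDiffeo p).surjective q)).trans
      ((expDiffeo p).apply_symm_apply q).symm)
  have h1 : normalChartInv (riemannianExp metric) p' b' x =
      projHomeo.symm (expCoord (projHomeo p') ((basisCoord b').symm x)) :=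
    riemannianExp_mkTangent p' _
  have h2 : ∀ q, normalChart (riemannianExp metric) p b q =
      basisCoord b (logCoord (projHomeo p) (projHomeo q)) := fun q =>
    congrArg (basisCoord b) (hinv q)
  rw [normalChange, Function.comp_apply, h1, h2, projHomeo.apply_symm_apply]

end HyperbolicPlane

theorem theorem5p2 :
    (∀ v : TangentBundle (𝓡 2) HyperbolicPlane,
      ∃! γ : ℝ → HyperbolicPlane, IsGeodesic HyperbolicPlane.metric γ ∧ velocity γ 0 = v) ∧
    HasSBoundedGeometry 1 (riemannianExp HyperbolicPlane.metric) := by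
  refine ⟨HyperbolicPlane.existsUnique_geodesic, HyperbolicPlane.isExponentialManifold,
    fun p p' b b' α _ => ?_⟩
  rw [HyperbolicPlane.normalChange_eq]
  exact HyperbolicPlane.exists_bound_logCoord_expCoord (HyperbolicPlane.projHomeo p)
    (HyperbolicPlane.projHomeo p') (HyperbolicPlane.basisCoord b : Eucl 2 →L[ℝ] Eucl 2)
    (HyperbolicPlane.basisCoord b').symm α
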